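/- **Setting.** Let $c>1$, $\gamma^*=1-1/c^2$ and $\kappa^*=\sqrt{(\gamma^*)^2/(1+(\gamma^*)^2)}$. Let $\mathcal D\subset\mathcal S^{d-1}$ consist of $n=n(d)$ independent uniformly random points of the unit sphere of $\mathbb R^d$, where $\log n=o(d)$ and $\log d=o(\log n)$ as $d\to\infty$ (sparse data: $n=2^{o(d)}$ and $d^{O(1)}=n^{o(1)}$), and put $\mu=\sqrt{1-n^{-2/d}}$. A uniformly random point $\mathbf p^*\in\mathcal D$ is the planted nearest neighbor, and the query $\mathbf q$ is uniformly random among the unit vectors with $\langle \mathbf p^*,\mathbf q\rangle=\gamma^*$. The $\alpha$-near neighbor graph has vertex set $\mathcal D$ and joins distinct points $\mathbf p,\mathbf p'$ when $\langle\mathbf p,\mathbf p'\rangle\ge\alpha$; the data structure stores for each $\mathbf p$ its bucket $\mathcal B(\mathbf p)$ of neighbors. One iteration of a query starts at a uniformly random $\mathbf p\in\mathcal D$. As long as $\langle\mathbf p,\mathbf q\rangle<\gamma^*$, it goes through the bucket of the current vertex, replacing $\mathbf p$ by $\mathbf p'$ whenever $\langle\mathbf p',\mathbf q\rangle\ge\langle\mathbf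 p,\mathbf q\rangle+1/d$; it fails if a complete pass makes no replacement, and returns $\mathbf p$ once $\langle\mathbf p,\mathbf q\rangle\ge\gamma^*$. Inserting a point compares it with all points of $\mathcal D$ and updates the buckets; deleting a point removes it from the buckets of its neighbors and empties its own bucket. An inner product costs $d$ steps, a comparison $1$ step, and an update of a bucket of size $m$ costs $O(1+\log m)$ steps. Space counts the coordinates of the points and $\lceil\log_2 n\rceil$ bits for each entry of each bucket. **Statement.** There are exponents $\rho_{\rm time},\rho_{\rm space},\rho_{\rm delete}$, functions of $c$ only, such that for every fixed $c>1$ and every sparse $n=n(d)$ one can choose $\alpha=[\kappa^*-o(1)]\cdot\mu$ (with $0<\alpha/\mu<\kappa^*$) for which, with probability tending to $1$ as $d\to\infty$, one iteration of the query algorithm, without starting over, returns $\mathbf p^*$, with $$\mathrm{Time}=n^{\rho_{\rm time}(c)+o(1)},\quad \mathrm{Space}=n^{\rho_{\rm space}(c)+o(1)},\quad \mathrm{Insert}=n^{1+o(1)},\quad \mathrm{Delete}=n^{\rho_{\rm delete}(c)+o(1)},$$ where the insertion cost is that of any new point of the sphere and the deletion cost that of any point of $\mathcal D$, simultaneously for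 all of them. As $c\to\infty$, $$\rho_{\rm time}(c)=\rho_{\rm delete}(c)=\tfrac12+\tfrac1{2c^2}+O(c^{-4}),\qquad \rho_{\rm space}(c)=\tfrac32+\tfrac1{2c^2}+O(c^{-4}),$$ and as $c\to1^+$, $$\rho_{\rm time}(c)=\rho_{\rm delete}(c)=1-4(c-1)^2+12(c-1)^3+O((c-1)^4),\qquad \rho_{\rm space}(c)=2-4(c-1)^2+12(c-1)^3+O((c-1)^4);$$ in particular these exponents are $1-4(c-1)^2+O((c-1)^3)$ and $2-4(c-1)^2+O((c-1)^3)$. (Equalities between two exponents mean that both have the stated expansion.) -/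

import Mathlib

open MeasureTheory Filter Asymptotics
open scoped Topology

noncomputable section

/-- Points of `ℝ^d` with the Euclidean norm. -/
abbrev Pt (d : ℕ) : Type := EuclideanSpace ℝ (Fin d)

/-- The Euclidean unit sphere of `ℝ^d`. -/
abbrev Sph (d : ℕ) : Type := Metric.sphere (0 : Pt d) 1

/-- The uniform probability distribution on the unit sphere (normalized surface measure). -/
def uniformSphere (d : ℕ) : Measure (Sph d) :=
  ((volume : Measure (Pt d)).toSphere Set.univ)⁻¹ • (volume : Measure (Pt d)).toSphere

theorem isProbabilityMeasure_uniformSphere {d : ℕ} (hd : 0 < d) :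
    IsProbabilityMeasure (uniformSphere d) := by
  have : Nonempty (Fin d) := ⟨⟨0, hd⟩⟩
  have : Nontrivial (Pt d) := inferInstance
  refine ⟨?_⟩
  rw [uniformSphere, Measure.smul_apply, smul_eq_mul]
  refine ENNReal.inv_mul_cancel ?_ (measure_ne_top _ _)
  rw [Ne, Measure.measure_univ_eq_zero]
  exact Measure.toSphere_ne_zero _

/-! ### The near neighbor graph and its data structure -/

section Algorithms

variable {d : ℕ} {ι : Type*}

/-- The `α`-near neighbor graph of a data set `P` (points indexed by labels): two distinct
vertices are joined when their inner product is at least `α`. -/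
def nearNeighborGraph (α : ℝ) (P : ι → Pt d) : SimpleGraph ι where
  Adj i j := i ≠ j ∧ α ≤ inner ℝ (P i) (P j)
  symm := ⟨fun _ _ h => ⟨h.1.symm, by rw [real_inner_comm]; exact h.2⟩⟩
  loopless := ⟨fun _ h => h.1 rfl⟩

open Classical in
/-- The data structure: for every stored label `i ∈ V` the bucket of its neighbors among the
stored labels (labels that are not stored have an empty bucket). -/
def buckets (α : ℝ) (P : ι → Pt d) (V : Finset ι) (i : ι) : Finset ι :=
  if i ∈ V then V.filter ((nearNeighborGraph α P).Adj i) else ∅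

variable [LinearOrder ι]

/-- One iteration of the inner `for` loop of a query `q`. The state consists of the current
vertex `p`, the flag `progress`, and the number of steps made. Vertex `j` replaces `p` when it is
closer to `q` by at least `1 / d` in inner product. The inner product of two vectors of `ℝ^d` costs
`d` steps, the comparison costs one. -/
def scanStep (P : ι → Pt d) (q : Pt d) (s : ι × Bool × ℕ) (j : ι) : ι × Bool × ℕ :=
  if inner ℝ (P s.1) q + 1 / (d : ℝ) ≤ inner ℝ (P j) q then (j, true, s.2.2 + (d + 1))
  else (s.1, s.2.1, s.2.2 + (d + 1))

/-- The inner `for` loop of a query, over the bucket of `p`. -/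
def scan (P : ι → Pt d) (B : ι → Finset ι) (q : Pt d) (p : ι) : ι × Bool × ℕ :=
  ((B p).sort (· ≤ ·)).foldl (scanStep P q) (p, false, 0)

/-- `Tour P B q γ p r t`: the query algorithm for `q` with target inner product `γ`, started at
vertex `p` and run until it first either returns or would start over, makes `t` steps; the outcome
is `r = some v` if it returns the vertex `v`, and `r = none` if it is stuck, that is, if it would
start over. Each evaluation of the test of the `while` loop costs `d + 1` steps. -/
inductive Tour (P : ι → Pt d) (B : ι → Finset ι) (q : Pt d) (γ : ℝ) : ι → Option ι → ℕ → Prop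
  | found (p : ι) (h : γ ≤ inner ℝ (P p) q) : Tour P B q γ p (some p) (d + 1)
  | advance (p : ι) (r : Option ι) (t : ℕ) (h : inner ℝ (P p) q < γ)
      (hp : (scan P B q p).2.1 = true) (ht : Tour P B q γ (scan P B q p).1 r t) :
      Tour P B q γ p r (d + 1 + (scan P B q p).2.2 + t)
  | stuck (p : ι) (h : inner ℝ (P p) q < γ) (hp : (scan P B q p).2.1 = false) :
      Tour P B q γ p none (d + 1 + (scan P B q p).2.2)

/-- The cost of inserting into, or removing from, a bucket kept as a balanced search tree. -/
def setOpCost (S : Finset ι) : ℕ := Nat.log 2 S.card + 1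

/-- Insertion of the label `x` into the data structure `B` with stored labels `V`: the new data
structure and the number of steps made. -/
def insertRun (α : ℝ) (P : ι → Pt d) (V : Finset ι) (x : ι) (B : ι → Finset ι) :
    (ι → Finset ι) × ℕ :=
  (V.sort (· ≤ ·)).foldl
    (fun s y =>
      if α ≤ inner ℝ (P x) (P y) then
        (Function.update (Function.update s.1 x (insert y (s.1 x))) y (insert x (s.1 y)),
          s.2 + (d + 1) + setOpCost (s.1 x) + setOpCost (s.1 y))
      else (s.1, s.2 + (d + 1)))
    (Function.update B x ∅, 1)

/-- Deletion of the label `x` from the data structure `B`: the new data structure and the number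
of steps made. -/
def deleteRun (x : ι) (B : ι → Finset ι) : (ι → Finset ι) × ℕ :=
  let s := ((B x).sort (· ≤ ·)).foldl
    (fun s y => (Function.update s.1 y ((s.1 y).erase x), s.2 + setOpCost (s.1 y))) (B, 0)
  (Function.update s.1 x ∅, s.2 + 1)

end Algorithms

/-- The cost of inserting a new vector `x` into the `α`-near neighbor graph of `n` points `P`;
the new vector gets the label `Fin.last n`. -/
def insertCost {d n : ℕ} (α : ℝ) (P : Fin n → Pt d) (x : Pt d) : ℕ :=
  let P' : Fin (n + 1) → Pt d := Fin.snoc (α := fun _ => Pt d) P x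
  let V : Finset (Fin (n + 1)) := Finset.univ.erase (Fin.last n)
  (insertRun α P' V (Fin.last n) (buckets α P' V)).2

/-- The cost of deleting the point with label `i` from the `α`-near neighbor graph of `P`. -/
def deleteCost {d n : ℕ} (α : ℝ) (P : Fin n → Pt d) (i : Fin n) : ℕ :=
  (deleteRun i (buckets α P Finset.univ)).2

/-- The space used by the data structure: `n * d` cells for the coordinates of the points, and
`⌈log₂ n⌉` bits for every label in every bucket. -/
def spaceCost {d n : ℕ} (α : ℝ) (P : Fin n → Pt d) : ℕ :=
  n * d + ∑ i, (buckets α P Finset.univ i).card * Nat.clog 2 n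

/-! ### Random instances -/

/-- The unit vector at inner product `γ` with the unit vector `p`, in the direction of the part
of `v` orthogonal to `p`. For `v` uniform on the sphere, it is uniformly distributed on the set of
unit vectors with inner product `γ` with `p`. -/
def plantedQuery {d : ℕ} (γ : ℝ) (p v : Pt d) : Pt d :=
  γ • p + √(1 - γ ^ 2) • (‖v - (inner ℝ p v : ℝ) • p‖⁻¹ • (v - (inner ℝ p v : ℝ) • p))

/-- The randomness of one planted instance and of one query on it. -/
structure Sample (d n : ℕ) where
  /-- the data points -/
  data : Fin n → Sph d
  /-- the label of the planted nearest neighbor -/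
  planted : Fin n
  /-- the direction in which the query lies from the planted nearest neighbor -/
  dir : Sph d
  /-- the random starting point of the query algorithm -/
  start : Fin n

namespace Sample

variable {d n : ℕ}

/-- A sample as a tuple. -/
def toProd (ω : Sample d n) : (Fin n → Sph d) × Fin n × Sph d × Fin n :=
  (ω.data, ω.planted, ω.dir, ω.start)

/-- The data points as vectors. -/
def pts (ω : Sample d n) (i : Fin n) : Pt d := ω.data i

/-- The query vector, at inner product `γ` with the planted nearest neighbor. -/
def query (ω : Sample d n) (γ : ℝ) : Pt d :=
  plantedQuery γ (ω.pts ω.planted) (ω.dir : Pt d)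

end Sample

/-- The joint law of a random instance: `n` independent uniform data points on the sphere, a
uniformly chosen one of which is the planted neighbor, a uniform direction for the query, and a
uniform starting point, all independent. -/
def sampleLaw (d n : ℕ) : Measure ((Fin n → Sph d) × Fin n × Sph d × Fin n) :=
  (Measure.pi fun _ => uniformSphere d).prod
    ((ProbabilityTheory.uniformOn Set.univ).prod
      ((uniformSphere d).prod (ProbabilityTheory.uniformOn Set.univ)))

theorem isProbabilityMeasure_sampleLaw {d n : ℕ} (hd : 0 < d) (hn : 0 < n) :
    IsProbabilityMeasure (sampleLaw d n) := by
  have := isProbabilityMeasure_uniformSphere hd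
  have : Nonempty (Fin n) := ⟨⟨0, hn⟩⟩
  unfold sampleLaw
  infer_instance

/-- An event has high probability, as `d → ∞` and with `n d` data points in dimension `d`, when
the (outer) probability of its complement tends to `0`. -/
def WithHighProbability (n : ℕ → ℕ) (E : ∀ d, Sample d (n d) → Prop) : Prop :=
  Tendsto (fun d => sampleLaw d (n d) (Sample.toProd '' {ω | ¬ E d ω})) atTop (𝓝 0)

/-! ### Parameters -/

/-- Sparse data sets: `n = 2^{o(d)}`, and `d^{O(1)} = n^{o(1)}`. -/
def IsSparse (n : ℕ → ℕ) : Prop :=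
  ((fun d => Real.log (n d)) =o[atTop] fun d => (d : ℝ)) ∧
    (fun d : ℕ => Real.log d) =o[atTop] fun d => Real.log (n d)

/-- The typical largest inner product `μ = √(1 - n^{-2/d})` of a query with `n` random points. -/
def muParam (d n : ℕ) : ℝ := √(1 - (n : ℝ) ^ (-(2 : ℝ) / d))

/-- The inner product of the query with its planted nearest neighbor for approximation factor
`c`. -/
def gammaStar (c : ℝ) : ℝ := 1 - 1 / c ^ 2

/-- The threshold for `α / μ` below which one iteration is enough. -/
def kappaStar (c : ℝ) : ℝ := √(gammaStar c ^ 2 / (1 + gammaStar c ^ 2))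

/-- `n^{ρ - ε} ≤ t ≤ n^{ρ + ε}`. -/
def PowerWithin (n : ℕ) (ρ ε : ℝ) (t : ℕ) : Prop :=
  (n : ℝ) ^ (ρ - ε) ≤ t ∧ (t : ℝ) ≤ (n : ℝ) ^ (ρ + ε)

end

/-! ### The query algorithm and the costs of the data structure -/

section Algorithms

variable {d : ℕ} {ι : Type*}

/-! Write γ for γ* and fix κ < κ*, α = κμ. Since (1 - μ²)^(d/2) = 1/n and μ → 0, a cap of height sμ
has measure n^(-s² + o(1)) for fixed s in [0, 1). Hence every bucket has n^(1 - κ² + o(1)) points,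
which gives all the costs once the number of passes is known to be O(d): every pass but the last
gains 1/d in an inner product that lies in [-1, 1].

Correctness rests on two facts about the walk that ignores the planted point p. First, two caps of
heights κμ and bμ around nearly orthogonal centres meet in a set of measure n^(-κ² - b² - o(1))
(`le_uniformSphere_wedge`). If κ² + b² < 1, this set contains data points around every vertex at
once, so the walk can stop only at a vertex e with ⟨e, q⟩ ≥ bμ (`IsSparse.tendsto_stuck`). Second,
given q, the point p is uniform on the slice ⟨p, q⟩ = γ and independent of that walk. Therefore ⟨e,
p⟩ ≥ γ⟨e, q⟩ - δμ with high probability (`pi_farEnd_le`). If κ < γb, it follows that p lies in the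
bucket of e. A suitable b exists exactly when κ/γ < √(1 - κ²), that is κ² < γ²/(1 + γ²) = κ*².

All other points have |⟨·, q⟩| < 2μ, far below γ. The true walk thus agrees with the one that
ignores p until it meets a bucket containing p, and the scan of that bucket ends at p
(`exists_tour`). The exponent 1 - κ² tends to 1/(1 + γ²) as κ → κ*, and a diagonal choice of κ turns
the results for fixed κ into one sequence. -/

theorem foldl_scanStep_cost (P : ι → Pt d) (q : Pt d) (l : List ι) (s : ι × Bool × ℕ) :
    (l.foldl (scanStep P q) s).2.2 = s.2.2 + l.length * (d + 1) := by
  induction l generalizing s with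
  | nil => simp
  | cons j l ih =>
    rw [List.foldl_cons, ih, List.length_cons]
    have : (scanStep P q s j).2.2 = s.2.2 + (d + 1) := by unfold scanStep; split_ifs <;> rfl
    rw [this]; ring

/-- Each replacement gains at least 1/d and nothing is ever lost, so a single replacement already
secures a gain of 1/d over the initial vertex. Without any replacement, every entry has been
compared with that same vertex, which is then a local optimum. -/
theorem foldl_scanStep_progress (P : ι → Pt d) (q : Pt d) (l : List ι) (s : ι × Bool × ℕ) :
    ((l.foldl (scanStep P q) s).1 = s.1 ∧ (l.foldl (scanStep P q) s).2.1 = s.2.1 ∧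
      ∀ j ∈ l, ¬ inner ℝ (P s.1) q + 1 / (d : ℝ) ≤ inner ℝ (P j) q) ∨
    ((l.foldl (scanStep P q) s).2.1 = true ∧ (l.foldl (scanStep P q) s).1 ∈ l ∧
      inner ℝ (P s.1) q + 1 / (d : ℝ) ≤ inner ℝ (P (l.foldl (scanStep P q) s).1) q) := by
  induction l generalizing s with
  | nil => simp
  | cons j l ih =>
    rw [List.foldl_cons]
    have hd : (0 : ℝ) ≤ 1 / d := by positivity
    by_cases hj : inner ℝ (P s.1) q + 1 / (d : ℝ) ≤ inner ℝ (P j) q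
    · have hs : scanStep P q s j = (j, true, s.2.2 + (d + 1)) := if_pos hj
      rw [hs]
      refine Or.inr ?_
      rcases ih (j, true, s.2.2 + (d + 1)) with ⟨h1, h2, -⟩ | ⟨h1, h2, h3⟩
      · exact ⟨h2, by rw [h1]; exact List.mem_cons_self, by rw [h1]; exact hj⟩
      · exact ⟨h1, List.mem_cons_of_mem _ h2, by linarith⟩
    · have hs : scanStep P q s j = (s.1, s.2.1, s.2.2 + (d + 1)) := if_neg hj
      rw [hs]
      rcases ih (s.1, s.2.1, s.2.2 + (d + 1)) with ⟨h1, h2, h3⟩ | ⟨h1, h2, h3⟩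
      · refine Or.inl ⟨h1, h2, fun k hk => ?_⟩
        rcases List.mem_cons.1 hk with rfl | hk
        · exact hj
        · exact h3 k hk
      · exact Or.inr ⟨h1, List.mem_cons_of_mem _ h2, h3⟩

/-- A scan that meets the unique best vertex `i` ends there. -/
theorem foldl_scanStep_best {P : ι → Pt d} {q : Pt d} {i : ι} (hd : 0 < d)
    (hi : ∀ j ≠ i, inner ℝ (P j) q + 1 / (d : ℝ) ≤ inner ℝ (P i) q) (l : List ι)
    (s : ι × Bool × ℕ) :
    (s.1 = i → (l.foldl (scanStep P q) s).1 = i) ∧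
      (i ∈ l → (l.foldl (scanStep P q) s).1 = i) := by
  have hd' : (0 : ℝ) < 1 / d := by positivity
  induction l generalizing s with
  | nil => simp
  | cons j l ih =>
    rw [List.foldl_cons]
    have key : s.1 = i → (scanStep P q s j).1 = i := by
      rintro h
      have hj : ¬ inner ℝ (P s.1) q + 1 / (d : ℝ) ≤ inner ℝ (P j) q := by
        rw [h]
        by_cases hji : j = i
        · rw [hji]; linarith
        · have := hi j hji; linarith
      rw [scanStep, if_neg hj]; exact h
    refine ⟨fun h => (ih _).1 (key h), fun h => ?_⟩
    rcases List.mem_cons.1 h with rfl | h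
    · refine (ih _).1 ?_
      by_cases hs : s.1 = i
      · exact key hs
      · rw [scanStep, if_pos (hi _ hs)]
    · exact (ih _).2 h

theorem setOpCost_le [Fintype ι] (S : Finset ι) :
    setOpCost S ≤ Nat.log 2 (Fintype.card ι) + 1 :=
  Nat.add_le_add_right (Nat.log_mono_right (Finset.card_le_univ S)) 1

variable [LinearOrder ι]

theorem scan_cost (P : ι → Pt d) (B : ι → Finset ι) (q : Pt d) (p : ι) :
    (scan P B q p).2.2 = (B p).card * (d + 1) := by
  rw [scan, foldl_scanStep_cost, Finset.length_sort, zero_add]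

theorem scan_progress (P : ι → Pt d) (B : ι → Finset ι) (q : Pt d) (p : ι) :
    ((scan P B q p).1 = p ∧ (scan P B q p).2.1 = false ∧
      ∀ j ∈ B p, ¬ inner ℝ (P p) q + 1 / (d : ℝ) ≤ inner ℝ (P j) q) ∨
    ((scan P B q p).2.1 = true ∧ (scan P B q p).1 ∈ B p ∧
      inner ℝ (P p) q + 1 / (d : ℝ) ≤ inner ℝ (P (scan P B q p).1) q) := by
  have := foldl_scanStep_progress P q ((B p).sort (· ≤ ·)) (p, false, 0)
  simp only [Finset.mem_sort] at this
  exact this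

theorem scan_best {P : ι → Pt d} {B : ι → Finset ι} {q : Pt d} {i p : ι} (hd : 0 < d)
    (hi : ∀ j ≠ i, inner ℝ (P j) q + 1 / (d : ℝ) ≤ inner ℝ (P i) q) (hp : i ∈ B p) :
    (scan P B q p).1 = i :=
  (foldl_scanStep_best hd hi _ _).2 (by simpa using hp)

/-- The vertex reached from `p` after `m` passes through buckets. -/
noncomputable def passes (P : ι → Pt d) (B : ι → Finset ι) (q : Pt d) (m : ℕ) (p : ι) : ι :=
  (fun p => (scan P B q p).1)^[m] p

theorem passes_succ (P : ι → Pt d) (B : ι → Finset ι) (q : Pt d) (m : ℕ) (p : ι) :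
    passes P B q (m + 1) p = passes P B q m (scan P B q p).1 := rfl

theorem passes_of_scan_eq {P : ι → Pt d} {B : ι → Finset ι} {q : Pt d} {p : ι}
    (h : (scan P B q p).1 = p) (m : ℕ) : passes P B q m p = p :=
  Function.iterate_fixed h m

/-- After enough passes the current vertex is a local optimum. -/
theorem passes_stuck {P : ι → Pt d} {B : ι → Finset ι} {q : Pt d} (hd : 0 < d)
    (hP : ∀ j, |inner ℝ (P j) q| ≤ 1) (p : ι) :
    ∀ j ∈ B (passes P B q (2 * d + 1) p),
      ¬ inner ℝ (P (passes P B q (2 * d + 1) p)) q + 1 / (d : ℝ) ≤ inner ℝ (P j) q := by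
  -- A walk that is idle once stays where it is. Otherwise m passes gain m/d, and m = 2d + 1 would
  -- exceed the length 2 of [-1, 1].
  have key : ∀ (m : ℕ) (p : ι), (∀ j ∈ B (passes P B q m p),
      ¬ inner ℝ (P (passes P B q m p)) q + 1 / (d : ℝ) ≤ inner ℝ (P j) q) ∨
      inner ℝ (P p) q + m * (1 / (d : ℝ)) ≤ inner ℝ (P (passes P B q m p)) q := by
    intro m
    induction m with
    | zero => intro p; right; simp [passes]
    | succ m ih =>
      intro p
      rcases scan_progress P B q p with ⟨h1, -, h2⟩ | ⟨-, -, h3⟩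
      · left; rw [passes_of_scan_eq h1]; exact h2
      · rw [passes_succ]
        rcases ih (scan P B q p).1 with h | h
        · exact Or.inl h
        · right; push_cast; linarith
  rcases key (2 * d + 1) p with h | h
  · exact h
  · exfalso
    have h1 := abs_le.1 (hP p)
    have h2 := abs_le.1 (hP (passes P B q (2 * d + 1) p))
    have hd' : (0 : ℝ) < d := by exact_mod_cast hd
    have : ((2 * d + 1 : ℕ) : ℝ) * (1 / (d : ℝ)) = 2 + 1 / d := by push_cast; field_simp
    rw [this] at h
    have : (0 : ℝ) < 1 / d := by positivity
    linarith

theorem passes_ne {P : ι → Pt d} {B : ι → Finset ι} {q : Pt d} {i : ι} (hB : ∀ j, i ∉ B j)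
    (m : ℕ) {p : ι} (hp : p ≠ i) : passes P B q m p ≠ i := by
  induction m generalizing p with
  | zero => exact hp
  | succ m ih =>
    rw [passes_succ]
    refine ih ?_
    rcases scan_progress P B q p with ⟨h1, -, -⟩ | ⟨-, h2, -⟩
    · rwa [h1]
    · exact fun h => hB p (h ▸ h2)

/-- If the walk that ignores the best vertex `i` ends at a neighbor of `i`, then the query
algorithm returns `i`. -/
theorem exists_tour {P : ι → Pt d} {B : ι → Finset ι} {q : Pt d} {γ : ℝ} {i : ι} {M : ℕ}
    (hd : 0 < d) (hγ : inner ℝ (P i) q = γ) (hi : ∀ j ≠ i, inner ℝ (P j) q + 1 / (d : ℝ) ≤ γ)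
    (hM : ∀ j, (B j).card ≤ M) (m : ℕ) {p : ι} (hp : p ≠ i)
    (he : i ∈ B (passes P (fun j => (B j).erase i) q m p)) :
    ∃ t, Tour P B q γ p (some i) t ∧ t ≤ (m + 2) * ((d + 1) * (M + 1)) := by
  have hd' : (0 : ℝ) < 1 / d := by positivity
  have hi' : ∀ j ≠ i, inner ℝ (P j) q + 1 / (d : ℝ) ≤ inner ℝ (P i) q := by rwa [hγ]
  -- One full pass, which ends at `i`, and then the test of the loop that returns it.
  have base : ∀ p, p ≠ i → i ∈ B p →
      ∃ t, Tour P B q γ p (some i) t ∧ t ≤ 2 * ((d + 1) * (M + 1)) := by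
    intro p hp hip
    have h1 := scan_best (q := q) hd hi' hip
    have hlt : inner ℝ (P p) q < γ := by linarith [hi p hp]
    refine ⟨_, Tour.advance p (some i) (d + 1) hlt ?_ (by rw [h1]; exact Tour.found i hγ.ge), ?_⟩
    · rcases scan_progress P B q p with ⟨h, -, -⟩ | ⟨h, -, -⟩
      · exact absurd (h.symm.trans h1) hp
      · exact h
    · rw [scan_cost]; nlinarith [hM p]
  induction m generalizing p with
  | zero => simpa using base p hp he
  | succ m ih =>
    have hlt : inner ℝ (P p) q < γ := by linarith [hi p hp]
    -- While the bucket of `p` does not contain `i`, erasing `i` changes nothing and both walks make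
    -- the same pass. Meeting `i` early only shortens the tour.
    by_cases hip : i ∈ B p
    · obtain ⟨t, h1, h2⟩ := base p hp hip
      exact ⟨t, h1, h2.trans (Nat.mul_le_mul_right _ (by omega))⟩
    · have hBp : (B p).erase i = B p := Finset.erase_eq_of_notMem hip
      have hscan : scan P (fun j => (B j).erase i) q p = scan P B q p := by
        simp only [scan, hBp]
      rw [passes_succ, hscan] at he
      -- An idle pass would leave the walk at `p` forever, although `he` puts `i` in the bucket of
      -- its last vertex.
      rcases scan_progress P B q p with ⟨h, -, -⟩ | ⟨h, h2, -⟩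
      · rw [h] at he
        rw [passes_of_scan_eq (by rw [hscan]; exact h)] at he
        exact absurd he hip
      · obtain ⟨t, h3, h4⟩ := ih (p := (scan P B q p).1) (fun h => hip (h ▸ h2)) he
        refine ⟨_, Tour.advance p (some i) t hlt h h3, ?_⟩
        rw [scan_cost]
        nlinarith [hM p]

/-- The first bucket is scanned in full unless the start already meets the target. This supplies the
lower bound for the query time. -/
theorem card_le_of_tour {P : ι → Pt d} {B : ι → Finset ι} {q : Pt d} {γ : ℝ} {p : ι}
    {r : Option ι} {t : ℕ} (h : Tour P B q γ p r t) (hp : inner ℝ (P p) q < γ) :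
    (B p).card ≤ t := by
  cases h with
  | found _ h => exact absurd h (not_le.2 hp)
  | advance _ _ t _ _ _ => rw [scan_cost]; nlinarith [Nat.zero_le ((B p).card * d)]
  | stuck _ _ _ => rw [scan_cost]; nlinarith [Nat.zero_le ((B p).card * d)]

/-! ### Costs of insertion and deletion. -/

theorem insertRun_cost [Fintype ι] (α : ℝ) (P : ι → Pt d) (V : Finset ι) (x : ι)
    (B : ι → Finset ι) :
    V.card * (d + 1) ≤ (insertRun α P V x B).2 ∧ (insertRun α P V x B).2 ≤
      V.card * (d + 1 + 2 * (Nat.log 2 (Fintype.card ι) + 1)) + 1 := by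
  have key : ∀ (l : List ι) (s : (ι → Finset ι) × ℕ),
      s.2 + l.length * (d + 1) ≤ (l.foldl (fun s y =>
        if α ≤ inner ℝ (P x) (P y) then
          (Function.update (Function.update s.1 x (insert y (s.1 x))) y (insert x (s.1 y)),
            s.2 + (d + 1) + setOpCost (s.1 x) + setOpCost (s.1 y))
        else (s.1, s.2 + (d + 1))) s).2 ∧ (l.foldl (fun s y =>
        if α ≤ inner ℝ (P x) (P y) then
          (Function.update (Function.update s.1 x (insert y (s.1 x))) y (insert x (s.1 y)),
            s.2 + (d + 1) + setOpCost (s.1 x) + setOpCost (s.1 y))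
        else (s.1, s.2 + (d + 1))) s).2 ≤
        s.2 + l.length * (d + 1 + 2 * (Nat.log 2 (Fintype.card ι) + 1)) := by
    intro l
    induction l with
    | nil => intro s; simp
    | cons y l ih =>
      intro s
      rw [List.foldl_cons, List.length_cons]
      refine ⟨le_trans ?_ (ih _).1, (ih _).2.trans ?_⟩
      · split_ifs
        · dsimp only; linarith [Nat.zero_le (setOpCost (s.1 x)), Nat.zero_le (setOpCost (s.1 y))]
        · dsimp only; linarith
      · split_ifs
        · dsimp only; linarith [setOpCost_le (s.1 x), setOpCost_le (s.1 y)]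
        · dsimp only; linarith
  have := key (V.sort (· ≤ ·)) (Function.update B x ∅, 1)
  rw [Finset.length_sort] at this
  unfold insertRun
  dsimp only at this
  exact ⟨by omega, by omega⟩

theorem deleteRun_cost [Fintype ι] (x : ι) (B : ι → Finset ι) :
    (B x).card ≤ (deleteRun x B).2 ∧
      (deleteRun x B).2 ≤ (B x).card * (Nat.log 2 (Fintype.card ι) + 1) + 1 := by
  have key : ∀ (l : List ι) (s : (ι → Finset ι) × ℕ),
      s.2 + l.length ≤ (l.foldl (fun s y =>
        (Function.update s.1 y ((s.1 y).erase x), s.2 + setOpCost (s.1 y))) s).2 ∧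
      (l.foldl (fun s y =>
        (Function.update s.1 y ((s.1 y).erase x), s.2 + setOpCost (s.1 y))) s).2 ≤
        s.2 + l.length * (Nat.log 2 (Fintype.card ι) + 1) := by
    intro l
    induction l with
    | nil => intro s; simp
    | cons y l ih =>
      intro s
      rw [List.foldl_cons, List.length_cons]
      refine ⟨le_trans ?_ (ih _).1, (ih _).2.trans ?_⟩
      · dsimp only [setOpCost]; omega
      · dsimp only; linarith [setOpCost_le (s.1 y)]
  have := key ((B x).sort (· ≤ ·)) (B, 0)
  rw [Finset.length_sort] at this
  unfold deleteRun
  dsimp only at this ⊢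
  exact ⟨by omega, by omega⟩

end Algorithms

theorem insertCost_bounds {d n : ℕ} (α : ℝ) (P : Fin n → Pt d) (x : Pt d) :
    n * (d + 1) ≤ insertCost α P x ∧
      insertCost α P x ≤ n * (d + 1 + 2 * (Nat.log 2 (n + 1) + 1)) + 1 := by
  have := insertRun_cost α (Fin.snoc (α := fun _ => Pt d) P x : Fin (n + 1) → Pt d)
    (Finset.univ.erase (Fin.last n)) (Fin.last n)
    (buckets α (Fin.snoc (α := fun _ => Pt d) P x : Fin (n + 1) → Pt d)
      (Finset.univ.erase (Fin.last n)))
  rw [Finset.card_erase_of_mem (Finset.mem_univ _), Finset.card_univ, Fintype.card_fin,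
    Nat.add_sub_cancel] at this
  exact this

theorem deleteCost_bounds {d n : ℕ} (α : ℝ) (P : Fin n → Pt d) (i : Fin n) :
    (buckets α P Finset.univ i).card ≤ deleteCost α P i ∧
      deleteCost α P i ≤ (buckets α P Finset.univ i).card * (Nat.log 2 n + 1) + 1 := by
  have := deleteRun_cost i (buckets α P Finset.univ)
  rw [Fintype.card_fin] at this
  exact this

theorem mem_buckets_univ {d n : ℕ} {α : ℝ} {P : Fin n → Pt d} {i j : Fin n} :
    j ∈ buckets α P Finset.univ i ↔ i ≠ j ∧ α ≤ inner ℝ (P i) (P j) := by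
  rw [buckets, if_pos (Finset.mem_univ i)]
  exact (@Finset.mem_filter _ _ (_) _ _).trans (and_iff_right (Finset.mem_univ j))

/-! ### Spherical caps and wedges -/

section Geometry

open scoped Pointwise

variable {d : ℕ}

/-- Surface measure is `d` times the volume of the cone over the set, so estimates on the sphere
become comparisons of volumes of sets in the unit ball. -/
theorem uniformSphere_real_apply (hd : 0 < d) {s : Set (Sph d)} (hs : MeasurableSet s) :
    (uniformSphere d).real s = (volume : Measure (Pt d)).real (Set.Ioo (0 : ℝ) 1 • (Subtype.val '' s)) /
      (volume : Measure (Pt d)).real (Metric.ball 0 1) := by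
  have hd' : (d : ℝ) ≠ 0 := by positivity
  rw [uniformSphere, measureReal_ennreal_smul_apply, ENNReal.toReal_inv, measureReal_def,
    Measure.toSphere_apply' _ hs, Measure.toSphere_apply_univ, ENNReal.toReal_mul,
    ENNReal.toReal_mul, ← measureReal_def, ← measureReal_def]
  simp only [finrank_euclideanSpace, Fintype.card_fin, ENNReal.toReal_natCast]
  field_simp

theorem volume_real_ball_pos : 0 < (volume : Measure (Pt d)).real (Metric.ball 0 1) :=
  ENNReal.toReal_pos (Metric.measure_ball_pos _ _ one_pos).ne' measure_ball_lt_top.ne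

theorem volume_real_ball (hd : 0 < d) (x : Pt d) {r : ℝ} (hr : 0 ≤ r) :
    (volume : Measure (Pt d)).real (Metric.ball x r) =
      r ^ d * (volume : Measure (Pt d)).real (Metric.ball 0 1) := by
  have : Nonempty (Fin d) := ⟨⟨0, hd⟩⟩
  rw [measureReal_def, Measure.addHaar_ball _ _ hr, ENNReal.toReal_mul,
    ENNReal.toReal_ofReal (by positivity), finrank_euclideanSpace, Fintype.card_fin, measureReal_def]

/-- Because r ≤ 1, r² - t² ≤ r²(1 - t²) ≤ r² exp(-t²). -/
theorem sqrt_sub_sq_pow_le {r t : ℝ} (hr : 0 ≤ r) (hr1 : r ≤ 1) :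
    √(r ^ 2 - t ^ 2) ^ d ≤ r ^ d * Real.exp (-(d * t ^ 2 / 2)) := by
  have h1 : √(r ^ 2 - t ^ 2) ≤ r * Real.exp (-(t ^ 2 / 2)) := by
    refine Real.sqrt_le_iff.2 ⟨by positivity, ?_⟩
    have h2 : (Real.exp (-(t ^ 2 / 2))) ^ 2 = Real.exp (-t ^ 2) := by
      rw [← Real.exp_nat_mul]; congr 1; push_cast; ring
    rw [mul_pow, h2]
    have h3 := Real.add_one_le_exp (-t ^ 2)
    nlinarith [sq_nonneg t, mul_nonneg (sq_nonneg t) (sub_nonneg.2 (pow_le_one₀ hr hr1 : r ^ 2 ≤ 1)),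
      mul_nonneg (sq_nonneg r) (sub_nonneg.2 h3)]
  calc √(r ^ 2 - t ^ 2) ^ d ≤ (r * Real.exp (-(t ^ 2 / 2))) ^ d := by gcongr
    _ = _ := by rw [mul_pow, ← Real.exp_nat_mul]; congr 2; ring

theorem measurableSet_cap (t : ℝ) (e : Pt d) :
    MeasurableSet {x : Sph d | t ≤ inner ℝ (x : Pt d) e} :=
  measurableSet_le measurable_const (by fun_prop)

/-- The measure of a spherical cap. -/
theorem uniformSphere_cap_le (hd : 0 < d) {t : ℝ} (ht : 0 ≤ t) (ht2 : t ^ 2 ≤ 1 / 2) {e : Pt d}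
    (he : ‖e‖ = 1) :
    (uniformSphere d).real {x | t ≤ inner ℝ (x : Pt d) e} ≤ Real.exp (-(d * t ^ 2 / 2)) := by
  rw [uniformSphere_real_apply hd (measurableSet_cap t e), div_le_iff₀ volume_real_ball_pos]
  -- The cone over the cap fits into the ball of radius √(1 - t²) about t·e. The condition t² ≤ 1/2
  -- is what lets this ball reach down to the apex.
  have hsub : Set.Ioo (0 : ℝ) 1 • (Subtype.val '' {x : Sph d | t ≤ inner ℝ (x : Pt d) e}) ⊆
      Metric.ball (t • e) (√(1 ^ 2 - t ^ 2)) := by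
    rintro _ ⟨r, ⟨hr0, hr1⟩, _, ⟨x, hx, rfl⟩, rfl⟩
    have hx1 : ‖(x : Pt d)‖ = 1 := by simp
    change t ≤ inner ℝ (x : Pt d) e at hx
    rw [Metric.mem_ball, dist_eq_norm]
    refine Real.lt_sqrt_of_sq_lt ?_
    simp only
    rw [norm_sub_sq_real, norm_smul, norm_smul, hx1, he, inner_smul_left, inner_smul_right,
      Real.norm_of_nonneg hr0.le, Real.norm_of_nonneg ht]
    simp only [RCLike.conj_to_real]
    nlinarith [mul_nonneg (mul_nonneg hr0.le ht) (sub_nonneg.2 hx),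
      mul_pos (sub_pos.2 hr1) (show 0 < 1 + r - 2 * t ^ 2 by linarith)]
  calc _ ≤ _ := measureReal_mono hsub measure_ball_lt_top.ne
    _ = _ := volume_real_ball hd _ (Real.sqrt_nonneg _)
    _ ≤ _ := by
      gcongr
      simpa using sqrt_sub_sq_pow_le (d := d) (t := t) zero_le_one le_rfl

/-- Almost all of a ball is nearly orthogonal to a given direction; this bounds the exceptional part
in the wedge estimate. -/
theorem volume_ball_cap_le (hd : 0 < d) {r t : ℝ} (hr : 0 ≤ r) (hr1 : r ≤ 1) (ht : 0 ≤ t)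
    {e : Pt d} (he : ‖e‖ = 1) :
    (volume : Measure (Pt d)).real {y | y ∈ Metric.ball 0 r ∧ t ≤ inner ℝ y e} ≤
      r ^ d * Real.exp (-(d * t ^ 2 / 2)) * (volume : Measure (Pt d)).real (Metric.ball 0 1) := by
  have hsub : {y : Pt d | y ∈ Metric.ball 0 r ∧ t ≤ inner ℝ y e} ⊆
      Metric.ball (t • e) (√(r ^ 2 - t ^ 2)) := by
    rintro y ⟨hy, hy2⟩
    rw [mem_ball_zero_iff] at hy
    rw [Metric.mem_ball, dist_eq_norm]
    refine Real.lt_sqrt_of_sq_lt ?_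
    rw [norm_sub_sq_real, norm_smul, he, inner_smul_right, Real.norm_of_nonneg ht]
    nlinarith [mul_nonneg ht (sub_nonneg.2 hy2), norm_nonneg y]
  calc _ ≤ _ := measureReal_mono hsub measure_ball_lt_top.ne
    _ = _ := volume_real_ball hd _ (Real.sqrt_nonneg _)
    _ ≤ _ := by gcongr; exact sqrt_sub_sq_pow_le hr hr1

/-- The measure of the intersection of two spherical caps. -/
theorem le_uniformSphere_wedge (hd : 0 < d) {x q : Pt d} (hx : ‖x‖ = 1) (hq : ‖q‖ = 1)
    {a b α β τ r : ℝ} (hα : 0 ≤ α) (hβ : 0 ≤ β) (ha : 0 ≤ a) (hb : 0 ≤ b) (hτ : 0 ≤ τ) (hr : 0 ≤ r)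
    (h1 : α + τ ≤ a + b * inner ℝ x q) (h2 : β + τ ≤ b + a * inner ℝ x q)
    (hr1 : a ^ 2 + b ^ 2 + 2 * a * b * inner ℝ x q + r ^ 2 + 2 * (a + b) * τ ≤ 1) :
    r ^ d * (1 - 4 * Real.exp (-(d * τ ^ 2 / 2))) ≤ (uniformSphere d).real
      {z | α ≤ inner ℝ (z : Pt d) x ∧ β ≤ inner ℝ (z : Pt d) q} := by
  have hmeas : MeasurableSet {z : Sph d | α ≤ inner ℝ (z : Pt d) x ∧ β ≤ inner ℝ (z : Pt d) q} :=
    (measurableSet_cap α x).inter (measurableSet_cap β q)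
  rw [uniformSphere_real_apply hd hmeas, le_div_iff₀ volume_real_ball_pos]
  set V := (volume : Measure (Pt d)).real (Metric.ball 0 1) with hV
  -- The part `A` of a ball of radius r that is nearly orthogonal to x and q is translated by z₀. By
  -- `h1` and `h2` the translate stays above both heights, and by `hr1` it stays inside the unit
  -- ball. Radial projection to the sphere divides by a norm below 1 and so keeps both inner
  -- products above α, β ≥ 0.
  set z₀ : Pt d := a • x + b • q with hz₀
  have hxx : inner ℝ x x = (1 : ℝ) := by rw [real_inner_self_eq_norm_sq, hx, one_pow]
  have hqq : inner ℝ q q = (1 : ℝ) := by rw [real_inner_self_eq_norm_sq, hq, one_pow]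
  have hz₀n : ‖z₀‖ ^ 2 = a ^ 2 + b ^ 2 + 2 * a * b * inner ℝ x q := by
    rw [← real_inner_self_eq_norm_sq, hz₀]
    simp only [inner_add_left, inner_add_right, real_inner_smul_left, real_inner_smul_right, hxx,
      hqq, real_inner_comm x q]
    ring
  have hr1' : r ≤ 1 := by nlinarith [sq_nonneg ‖z₀‖, mul_nonneg (add_nonneg ha hb) hτ]
  set A : Set (Pt d) := {y | y ∈ Metric.ball 0 r ∧ |inner ℝ y x| < τ ∧ |inner ℝ y q| < τ} with hA
  let C (e : Pt d) : Set (Pt d) := {y | y ∈ Metric.ball 0 r ∧ τ ≤ inner ℝ y e}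
  have hC (e : Pt d) (he : ‖e‖ = 1) := volume_ball_cap_le hd hr hr1' hτ he
  -- What `A` misses lies in four caps of the ball, in the directions ±x and ±q; hence the factor 4.
  have hcover : Metric.ball (0 : Pt d) r ⊆ A ∪ (C x ∪ C (-x) ∪ (C q ∪ C (-q))) := by
    intro y hy
    by_cases hyA : y ∈ A
    · exact Or.inl hyA
    right
    have : ¬ |inner ℝ y x| < τ ∨ ¬ |inner ℝ y q| < τ := by
      by_contra! hcon
      exact hyA ⟨hy, hcon⟩
    rcases this with h | h
    · left
      rcases le_abs.1 (not_lt.1 h) with h | h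
      · exact Or.inl ⟨hy, h⟩
      · exact Or.inr ⟨hy, by rwa [inner_neg_right]⟩
    · right
      rcases le_abs.1 (not_lt.1 h) with h | h
      · exact Or.inl ⟨hy, h⟩
      · exact Or.inr ⟨hy, by rwa [inner_neg_right]⟩
  have hfin : ∀ s ⊆ Metric.ball (0 : Pt d) r, (volume : Measure (Pt d)) s ≠ ⊤ := fun s hs =>
    ((measure_mono hs).trans_lt measure_ball_lt_top).ne
  have hAsub : A ⊆ Metric.ball (0 : Pt d) r := fun y hy => hy.1
  have hCsub (e : Pt d) : C e ⊆ Metric.ball (0 : Pt d) r := fun y hy => hy.1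
  have hball : r ^ d * V ≤ (volume : Measure (Pt d)).real A +
      4 * (r ^ d * Real.exp (-(d * τ ^ 2 / 2)) * V) := by
    rw [hV, ← volume_real_ball hd 0 hr]
    refine (measureReal_mono hcover (hfin _ ?_)).trans ?_
    · simp only [Set.union_subset_iff]
      exact ⟨hAsub, ⟨hCsub _, hCsub _⟩, hCsub _, hCsub _⟩
    · refine (measureReal_union_le _ _).trans ?_
      refine add_le_add_right ?_ _
      refine (measureReal_union_le _ _).trans ?_
      refine (add_le_add (measureReal_union_le _ _) (measureReal_union_le _ _)).trans ?_
      have e1 := hC x hx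
      have e2 := hC (-x) (by rwa [norm_neg])
      have e3 := hC q hq
      have e4 := hC (-q) (by rwa [norm_neg])
      linarith
  have hsub : (fun y => z₀ + y) '' A ⊆ Set.Ioo (0 : ℝ) 1 • (Subtype.val ''
      {z : Sph d | α ≤ inner ℝ (z : Pt d) x ∧ β ≤ inner ℝ (z : Pt d) q}) := by
    rintro _ ⟨y, ⟨hy, hyx, hyq⟩, rfl⟩
    simp only
    rw [mem_ball_zero_iff] at hy
    rw [abs_lt] at hyx hyq
    have hzx : α < inner ℝ (z₀ + y) x := by
      rw [hz₀]
      simp only [inner_add_left, real_inner_smul_left, hxx, real_inner_comm x q]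
      linarith
    have hzq : β < inner ℝ (z₀ + y) q := by
      rw [hz₀]
      simp only [inner_add_left, real_inner_smul_left, hqq]
      linarith
    set z := z₀ + y with hz
    have hz0 : z ≠ 0 := by
      rintro h
      rw [h, inner_zero_left] at hzx
      linarith
    have hzpos : 0 < ‖z‖ := norm_pos_iff.2 hz0
    have hz1 : ‖z‖ < 1 := by
      have : ‖z‖ ^ 2 < 1 := by
        rw [hz, norm_add_sq_real, hz₀n]
        have : inner ℝ z₀ y ≤ (a + b) * τ := by
          rw [hz₀]
          simp only [inner_add_left, real_inner_smul_left]
          rw [real_inner_comm y x, real_inner_comm y q]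
          nlinarith
        nlinarith [norm_nonneg y]
      nlinarith
    have hunit : ‖(‖z‖⁻¹ • z)‖ = 1 := by
      rw [norm_smul, norm_inv, norm_norm, inv_mul_cancel₀ hzpos.ne']
    refine ⟨‖z‖, ⟨hzpos, hz1⟩, ‖z‖⁻¹ • z, ⟨⟨‖z‖⁻¹ • z, by simpa using hunit⟩, ⟨?_, ?_⟩, rfl⟩, ?_⟩
    · simp only [real_inner_smul_left]
      rw [inv_mul_eq_div, le_div_iff₀ hzpos]
      nlinarith
    · simp only [real_inner_smul_left]
      rw [inv_mul_eq_div, le_div_iff₀ hzpos]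
      nlinarith
    · simp only [smul_smul]
      rw [mul_inv_cancel₀ hzpos.ne', one_smul]
  have hmono := measureReal_mono (μ := (volume : Measure (Pt d))) hsub ?_
  · have : (volume : Measure (Pt d)).real ((fun y => z₀ + y) '' A) =
        (volume : Measure (Pt d)).real A := by
      rw [Set.image_add_left, measureReal_def, measure_preimage_add, measureReal_def]
    rw [this] at hmono
    linarith
  · refine ((measure_mono (?_ : _ ⊆ Metric.ball (0 : Pt d) 1)).trans_lt measure_ball_lt_top).ne
    rintro _ ⟨s, ⟨hs0, hs1⟩, _, ⟨x, -, rfl⟩, rfl⟩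
    have hx1 : ‖(x : Pt d)‖ = 1 := by simp
    simp only
    rw [mem_ball_zero_iff, norm_smul, hx1, mul_one, Real.norm_of_nonneg hs0.le]
    exact hs1

end Geometry

/-! ### Resampling one coordinate and binomial tails -/

section Product

theorem measurableSet_coord {S ι : Type*} [MeasurableSpace S] {W : S → Set S} (hW : MeasurableSet {x : S × S | x.2 ∈ W x.1})
    (j k : ι) : MeasurableSet {D : ι → S | D k ∈ W (D j)} :=
  have h : Measurable fun D : ι → S => (D j, D k) := by fun_prop
  h hW

open Classical in
theorem measurable_card_filter {ι X : Type*} [MeasurableSpace X] (T : Finset ι) {p : ι → X → Prop}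
    (hp : ∀ k, MeasurableSet {x | p k x}) :
    Measurable fun x => (T.filter fun k => p k x).card := by
  simp only [Finset.card_filter]
  exact Finset.measurable_fun_sum _ fun k _ =>
    Measurable.ite (hp k) measurable_const measurable_const

variable {S ι : Type*} [MeasurableSpace S] [Fintype ι] [DecidableEq ι]
  {ν : Measure S} [IsProbabilityMeasure ν]

theorem measurePreserving_update (i : ι) :
    MeasurePreserving (fun x : (ι → S) × S => Function.update x.1 i x.2)
      ((Measure.pi fun _ => ν).prod ν) (Measure.pi fun _ => ν) := by
  have hmeas : Measurable fun x : (ι → S) × S => Function.update x.1 i x.2 := by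
    refine measurable_pi_iff.2 fun j => ?_
    by_cases h : j = i
    · subst h; simpa using measurable_snd
    · simp only [Function.update_of_ne h]
      exact (measurable_pi_apply j).comp measurable_fst
  refine ⟨hmeas, (Measure.pi_eq fun s hs => ?_).symm⟩
  rw [Measure.map_apply hmeas (MeasurableSet.univ_pi hs)]
  have : (fun x : (ι → S) × S => Function.update x.1 i x.2) ⁻¹' Set.univ.pi s =
      (Set.univ.pi fun j => if j = i then Set.univ else s j) ×ˢ s i := by
    ext ⟨D, p⟩
    simp only [Set.mem_preimage, Set.mem_univ_pi, Set.mem_prod]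
    constructor
    · intro h
      refine ⟨fun j => ?_, by simpa using h i⟩
      by_cases hj : j = i
      · simp [hj]
      · simpa [hj] using h j
    · rintro ⟨h, h'⟩ j
      by_cases hj : j = i
      · subst hj; simpa using h'
      · simpa [hj] using h j
  rw [this, Measure.prod_prod, Measure.pi_pi, ← Finset.prod_erase_mul _ _ (Finset.mem_univ i)]
  conv_rhs => rw [← Finset.prod_erase_mul _ _ (Finset.mem_univ i)]
  simp only [if_true, measure_univ, mul_one]
  congr 1
  refine Finset.prod_congr rfl fun j hj => ?_
  rw [if_neg (Finset.ne_of_mem_erase hj)]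

/-- Fubini after resampling coordinate `i`: that coordinate can be frozen at any value while the
others stay independent. -/
theorem pi_le_of_update (i : ι) {A : Set (ι → S)} (hA : MeasurableSet A) {δ : ENNReal}
    (h : ∀ p, Measure.pi (fun _ => ν) {D | Function.update D i p ∈ A} ≤ δ) :
    Measure.pi (fun _ => ν) A ≤ δ := by
  rw [← (measurePreserving_update i).measure_preimage hA.nullMeasurableSet,
    Measure.prod_apply_symm ((measurePreserving_update i (ν := ν)).measurable hA)]
  calc _ ≤ ∫⁻ _ : S, δ ∂ν := lintegral_mono fun p => h p
    _ = δ := by simp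

open Classical in
-- The generating function of a binomial variable: the power is a product of independent factors,
-- one for each coordinate in `T`.
theorem integral_pow_card {C : Set S} (hC : MeasurableSet C) (T : Finset ι) (a : ℝ) :
    Integrable (fun D : ι → S => a ^ (T.filter fun k => D k ∈ C).card) (Measure.pi fun _ => ν) ∧
    ∫ D : ι → S, a ^ (T.filter fun k => D k ∈ C).card ∂(Measure.pi fun _ => ν) =
      (1 + (a - 1) * ν.real C) ^ T.card := by
  let f : ι → S → ℝ := fun k => if k ∈ T then fun x => 1 + C.indicator (fun _ => a - 1) x else 1
  have hf : ∀ D : ι → S, a ^ (T.filter fun k => D k ∈ C).card = ∏ k, f k (D k) := by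
    intro D
    rw [← Finset.prod_const, Finset.prod_filter]
    rw [← Finset.prod_subset (Finset.subset_univ T)
      (fun k _ hk => by simp only [f, if_neg hk, Pi.one_apply])]
    refine Finset.prod_congr rfl fun k hk => ?_
    simp only [f, if_pos hk, Set.indicator]
    split_ifs <;> ring
  have hind : Integrable (fun x => C.indicator (fun _ => a - 1) x) ν :=
    (integrable_const _).indicator hC
  simp only [hf]
  constructor
  · refine Integrable.fintype_prod (f := f) fun k => ?_
    by_cases hk : k ∈ T
    · simp only [f, if_pos hk]
      exact (integrable_const _).add hind
    · simp only [f, if_neg hk]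
      exact integrable_const _
  · rw [integral_fintype_prod_eq_prod, ← Finset.prod_subset (Finset.subset_univ T)
      (fun k _ hk => by simp [f, if_neg hk]), ← Finset.prod_const]
    refine Finset.prod_congr rfl fun k hk => ?_
    simp only [f, if_pos hk]
    rw [integral_add (integrable_const _) hind, integral_indicator hC]
    simp [mul_comm]

open Classical in
-- Markov's inequality for the generating function, with 1 + x ≤ exp x. Taking a = 2 gives the upper
-- tail and a = 1/2 the lower tail.
theorem pi_real_pow_le {C : Set S} (hC : MeasurableSet C) (T : Finset ι) {a b : ℝ} (ha : 0 < a)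
    (hb : 0 < b) :
    (Measure.pi fun _ => ν).real {D : ι → S | b ≤ a ^ (T.filter fun k => D k ∈ C).card} ≤
      Real.exp ((a - 1) * ν.real C * T.card) / b := by
  rw [le_div_iff₀' hb]
  have h := integral_pow_card (ν := ν) hC T a
  refine (mul_meas_ge_le_integral_of_nonneg (ae_of_all _ fun D => by positivity) h.1 b).trans ?_
  rw [h.2, mul_comm _ (T.card : ℝ), Real.exp_nat_mul]
  have h0 : 0 ≤ 1 + (a - 1) * ν.real C := by
    have := measureReal_le_one (μ := ν) (s := C)
    have := measureReal_nonneg (μ := ν) (s := C)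
    nlinarith
  gcongr
  rw [add_comm]
  exact Real.add_one_le_exp _

open Classical in
/-- Upper tail of the number of coordinates in a set that depends on one other coordinate. -/
theorem pi_le_card_filter {W : S → Set S} (hW : MeasurableSet {x : S × S | x.2 ∈ W x.1}) {j : ι}
    {T : Finset ι} (hj : j ∉ T) {p : ℝ} (hp : ∀ x, ν.real (W x) ≤ p) (K : ℕ) :
    Measure.pi (fun _ => ν) {D : ι → S | K ≤ (T.filter fun k => D k ∈ W (D j)).card} ≤
      ENNReal.ofReal (Real.exp (p * T.card) / 2 ^ K) := by
  -- Freezing coordinate `j` at `x` makes the random set the fixed set `W x`; as `j ∉ T`, the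
  -- counted coordinates are not affected.
  refine pi_le_of_update j (measurableSet_le measurable_const
    (measurable_card_filter T fun k => measurableSet_coord hW j k)) fun x => ?_
  have hWx : MeasurableSet (W x) := hW.preimage measurable_prodMk_left
  refine (ENNReal.le_ofReal_iff_toReal_le (measure_ne_top _ _) (by positivity)).2 ?_
  have h := pi_real_pow_le (ν := ν) hWx T (a := 2) (b := 2 ^ K) (by norm_num) (by positivity)
  refine le_trans (measureReal_mono ?_) (h.trans ?_)
  · intro D hD
    simp only [Set.mem_ofPred_eq, Function.update_self] at hD ⊢
    refine pow_le_pow_right₀ (by norm_num) (hD.trans (le_of_eq ?_))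
    congr 1
    refine Finset.filter_congr fun k hk => ?_
    rw [Function.update_of_ne (ne_of_mem_of_not_mem hk hj)]
  · gcongr
    have := hp x
    linarith

open Classical in
/-- Lower tail of the number of coordinates in a set that depends on one other coordinate. -/
theorem pi_card_filter_le {W : S → Set S} (hW : MeasurableSet {x : S × S | x.2 ∈ W x.1}) {j : ι}
    {T : Finset ι} (hj : j ∉ T) {G : Set S} (hG : MeasurableSet G) {p : ℝ}
    (hp : ∀ x ∈ G, p ≤ ν.real (W x)) (K : ℕ) :
    Measure.pi (fun _ => ν)
        {D : ι → S | D j ∈ G ∧ (T.filter fun k => D k ∈ W (D j)).card ≤ K} ≤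
      ENNReal.ofReal (2 ^ K * Real.exp (-(p * T.card / 2))) := by
  refine pi_le_of_update j ((hG.preimage (measurable_pi_apply j)).inter (measurableSet_le
    (measurable_card_filter T fun k => measurableSet_coord hW j k) measurable_const)) fun x => ?_
  by_cases hx : x ∈ G
  swap
  · simp [hx]
  have hWx : MeasurableSet (W x) := hW.preimage measurable_prodMk_left
  refine (ENNReal.le_ofReal_iff_toReal_le (measure_ne_top _ _) (by positivity)).2 ?_
  have h := pi_real_pow_le (ν := ν) hWx T (a := 1 / 2) (b := (1 / 2) ^ K) (by norm_num)
    (by positivity)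
  refine le_trans (measureReal_mono ?_) (h.trans ?_)
  · rintro D ⟨-, hD⟩
    simp only [Set.mem_ofPred_eq, Function.update_self] at hD ⊢
    refine pow_le_pow_of_le_one (by norm_num) (by norm_num) (le_trans (le_of_eq ?_) hD)
    congr 1
    refine Finset.filter_congr fun k hk => ?_
    rw [Function.update_of_ne (ne_of_mem_of_not_mem hk hj)]
  · rw [one_div, inv_pow, div_inv_eq_mul, mul_comm]
    gcongr
    have h1 := hp x hx
    have h2 : (0 : ℝ) ≤ T.card := by positivity
    nlinarith

end Product

/-! ### Symmetry of the sphere -/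

section Rotation

open scoped Pointwise

variable {d : ℕ}

/-- The action of a linear isometry on the sphere. -/
noncomputable def sphereMap (T : Pt d ≃ₗᵢ[ℝ] Pt d) (x : Sph d) : Sph d := ⟨T x, by simp⟩

theorem measurable_sphereMap (T : Pt d ≃ₗᵢ[ℝ] Pt d) : Measurable (sphereMap T) :=
  (T.continuous.measurable.comp measurable_subtype_coe).subtype_mk

theorem measurePreserving_sphereMap (hd : 0 < d) (T : Pt d ≃ₗᵢ[ℝ] Pt d) :
    MeasurePreserving (sphereMap T) (uniformSphere d) (uniformSphere d) := by
  have := isProbabilityMeasure_uniformSphere hd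
  refine ⟨measurable_sphereMap T, Measure.ext fun s hs => ?_⟩
  rw [Measure.map_apply (measurable_sphereMap T) hs]
  have hs' := measurable_sphereMap T hs
  rw [← ENNReal.toReal_eq_toReal_iff' (measure_ne_top _ _) (measure_ne_top _ _)]
  change (uniformSphere d).real _ = (uniformSphere d).real _
  rw [uniformSphere_real_apply hd hs', uniformSphere_real_apply hd hs]
  congr 1
  have : Set.Ioo (0 : ℝ) 1 • (Subtype.val '' (sphereMap T ⁻¹' s)) =
      T.toMeasurableEquiv ⁻¹' (Set.Ioo (0 : ℝ) 1 • (Subtype.val '' s)) := by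
    ext y
    constructor
    · rintro ⟨r, hr, _, ⟨x, hx, rfl⟩, rfl⟩
      exact ⟨r, hr, T x, ⟨sphereMap T x, hx, rfl⟩, (T.map_smul r (x : Pt d)).symm⟩
    · rintro ⟨r, hr, _, ⟨x, hx, rfl⟩, hxy⟩
      refine ⟨r, hr, T.symm x, ⟨sphereMap T.symm x, ?_, rfl⟩, ?_⟩
      · have : sphereMap T (sphereMap T.symm x) = x := Subtype.ext (T.apply_symm_apply _)
        rwa [Set.mem_preimage, this]
      · apply T.injective
        change T (r • T.symm (x : Pt d)) = T y
        rw [T.map_smul, T.apply_symm_apply]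
        exact hxy
  rw [this, measureReal_def, measureReal_def]
  congr 1
  exact T.measurePreserving.measure_preimage_equiv _

theorem measurePreserving_pi_sphereMap (hd : 0 < d) {n : ℕ} (T : Pt d ≃ₗᵢ[ℝ] Pt d) :
    MeasurePreserving (fun (D : Fin n → Sph d) i => sphereMap T (D i))
      (Measure.pi fun _ => uniformSphere d) (Measure.pi fun _ => uniformSphere d) := by
  have := isProbabilityMeasure_uniformSphere hd
  exact measurePreserving_pi _ _ fun _ => measurePreserving_sphereMap hd T

/-- Unit vectors at the same inner product with `q` are exchanged by an isometry fixing `q`. -/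
theorem exists_isometry_fixing {p p' q : Pt d} (hp : ‖p‖ = ‖p'‖)
    (h : inner ℝ p q = (inner ℝ p' q : ℝ)) : ∃ T : Pt d ≃ₗᵢ[ℝ] Pt d, T p = p' ∧ T q = q := by
  -- The reflection in the hyperplane orthogonal to p - p' exchanges p and p', and q lies in this
  -- hyperplane.
  refine ⟨(ℝ ∙ (p - p'))ᗮ.reflection, Submodule.reflection_sub hp, ?_⟩
  rw [Submodule.reflection_eq_self_iff, Submodule.mem_orthogonal_singleton_iff_inner_right,
    inner_sub_left, h, sub_self]

end Rotation

/-! ### The law of a random instance -/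

section SampleLaw

variable {d n : ℕ}

/-- Conditioning on the two labels and the direction leaves only the randomness of the data. The
labels are finitely many, so measurability for each fixed pair of them is enough. -/
theorem sampleLaw_le (hd : 0 < d) (hn : 0 < n) {A : Set ((Fin n → Sph d) × Fin n × Sph d × Fin n)}
    (hA : ∀ i s, MeasurableSet {x : (Fin n → Sph d) × Sph d | (x.1, i, x.2, s) ∈ A}) {δ : ENNReal}
    (h : ∀ i v s, Measure.pi (fun _ => uniformSphere d) {D | (D, i, v, s) ∈ A} ≤ δ) :
    sampleLaw d n A ≤ δ := by
  have := isProbabilityMeasure_uniformSphere hd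
  have : Nonempty (Fin n) := ⟨⟨0, hn⟩⟩
  have hA' : MeasurableSet A := by
    have : A = ⋃ i, ⋃ s, {x | (x.1, i, x.2.2.1, s) ∈ A ∧ x.2.1 = i ∧ x.2.2.2 = s} := by
      ext ⟨D, i, v, s⟩
      simp
    rw [this]
    refine MeasurableSet.iUnion fun i => MeasurableSet.iUnion fun s => ?_
    refine MeasurableSet.inter ((hA i s).preimage (f := fun x :
      (Fin n → Sph d) × Fin n × Sph d × Fin n => (x.1, x.2.2.1)) (by fun_prop)) (.inter ?_ ?_)
    · exact (measurableSet_singleton i).preimage (by fun_prop)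
    · exact (measurableSet_singleton s).preimage (by fun_prop)
  rw [sampleLaw, Measure.prod_apply_symm hA']
  refine le_trans (lintegral_mono (g := fun _ => δ) fun y => h y.1 y.2.1 y.2.2) ?_
  simp

theorem sampleLaw_planted_eq_start (hd : 0 < d) (hn : 0 < n) :
    sampleLaw d n {x | x.2.1 = x.2.2.2} ≤ (n : ENNReal)⁻¹ := by
  have := isProbabilityMeasure_uniformSphere hd
  have : Nonempty (Fin n) := ⟨⟨0, hn⟩⟩
  have hA : MeasurableSet {x : (Fin n → Sph d) × Fin n × Sph d × Fin n | x.2.1 = x.2.2.2} :=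
    measurableSet_eq_fun (by fun_prop) (by fun_prop)
  rw [sampleLaw, Measure.prod_apply hA]
  refine le_trans (lintegral_mono (g := fun _ => (n : ENNReal)⁻¹) fun D => ?_) (by simp)
  rw [Measure.prod_apply (hA.preimage measurable_prodMk_left)]
  refine le_trans (lintegral_mono (g := fun _ => (n : ENNReal)⁻¹) fun i => ?_) (by simp)
  have : Prod.mk i ⁻¹' (Prod.mk D ⁻¹' {x | x.2.1 = x.2.2.2}) =
      (Set.univ : Set (Sph d)) ×ˢ ({i} : Set (Fin n)) := by
    ext ⟨v, s⟩; simp [eq_comm]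
  rw [this, Measure.prod_prod, ProbabilityTheory.uniformOn_univ]
  simp

end SampleLaw

/-! ### The planted query and the walk that ignores the planted point -/

section Planted

variable {d n : ℕ}

theorem norm_sub_inner_smul_sq {p v : Pt d} (hp : ‖p‖ = 1) (hv : ‖v‖ = 1) :
    ‖v - (inner ℝ p v : ℝ) • p‖ ^ 2 = 1 - inner ℝ p v ^ 2 := by
  rw [norm_sub_sq_real, norm_smul, hp, hv, real_inner_smul_right, real_inner_comm p v,
    Real.norm_eq_abs, mul_one, sq_abs]
  ring

theorem inner_plantedQuery_left {p : Pt d} (hp : ‖p‖ = 1) (v : Pt d) (γ : ℝ) :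
    inner ℝ p (plantedQuery γ p v) = γ := by
  have hpp : inner ℝ p p = (1 : ℝ) := by rw [real_inner_self_eq_norm_sq, hp, one_pow]
  rw [plantedQuery]
  simp only [inner_add_right, inner_sub_right, real_inner_smul_right, hpp]
  ring

/-- The bound on |⟨p, v⟩| excludes v = ±p, where the orthogonal part of v vanishes and cannot be
normalized. -/
theorem norm_plantedQuery {p v : Pt d} (hp : ‖p‖ = 1) (hv : ‖v‖ = 1) {γ : ℝ} (hγ : γ ^ 2 ≤ 1)
    (h : |(inner ℝ p v : ℝ)| < 1) : ‖plantedQuery γ p v‖ = 1 := by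
  have hpp : inner ℝ p p = (1 : ℝ) := by rw [real_inner_self_eq_norm_sq, hp, one_pow]
  have hw : 0 < ‖v - (inner ℝ p v : ℝ) • p‖ ^ 2 := by
    rw [norm_sub_inner_smul_sq hp hv, sub_pos, sq_lt_one_iff_abs_lt_one]; exact h
  have hw' : ‖v - (inner ℝ p v : ℝ) • p‖ ≠ 0 := fun h0 => by simp [h0] at hw
  have h1 : ‖plantedQuery γ p v‖ ^ 2 = 1 := by
    rw [plantedQuery, norm_add_sq_real, norm_smul, norm_smul, norm_smul, norm_inv, norm_norm,
      inv_mul_cancel₀ hw', hp, mul_one, mul_one, Real.norm_eq_abs, Real.norm_eq_abs, sq_abs, sq_abs,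
      Real.sq_sqrt (by linarith)]
    simp only [inner_sub_right, real_inner_smul_left, real_inner_smul_right, hpp]
    ring
  exact (pow_eq_one_iff_of_nonneg (norm_nonneg _) two_ne_zero).1 h1

theorem measurable_plantedQuery {X : Type*} [MeasurableSpace X] {γ : ℝ} {p v : X → Pt d}
    (hp : Measurable p) (hv : Measurable v) : Measurable fun x => plantedQuery γ (p x) (v x) := by
  unfold plantedQuery
  fun_prop

/-- The last vertex of the walk from `s` that ignores the vertex `i`. -/
noncomputable def walkEnd (α : ℝ) (P : Fin n → Pt d) (q : Pt d) (i s : Fin n) : Fin n :=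
  passes P (fun j => (buckets α P Finset.univ j).erase i) q (2 * d + 1) s

/-- The walk sees the points only through the outcomes of comparisons. Both its invariance under
isometries and its measurability come from this. -/
theorem walkEnd_congr {α : ℝ} {P P' : Fin n → Pt d} {q q' : Pt d} {i : Fin n}
    (h1 : ∀ j k, α ≤ inner ℝ (P j) (P k) ↔ α ≤ inner ℝ (P' j) (P' k))
    (h2 : ∀ j k, inner ℝ (P j) q + 1 / (d : ℝ) ≤ inner ℝ (P k) q ↔
      inner ℝ (P' j) q' + 1 / (d : ℝ) ≤ inner ℝ (P' k) q') (s : Fin n) :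
    walkEnd α P q i s = walkEnd α P' q' i s := by
  have hB : buckets α P Finset.univ = buckets α P' Finset.univ := by
    funext j
    ext k
    rw [mem_buckets_univ, mem_buckets_univ, h1]
  have hstep : scanStep P q = scanStep P' q' := by
    funext s j
    unfold scanStep
    exact if_congr (h2 s.1 j) rfl rfl
  unfold walkEnd passes scan
  rw [hB, hstep]

theorem foldl_scanStep_congr_of_ne {P P' : Fin n → Pt d} {i : Fin n} (h : ∀ j ≠ i, P j = P' j)
    (q : Pt d) (l : List (Fin n)) (hl : i ∉ l) (s : Fin n × Bool × ℕ) (hs : s.1 ≠ i) :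
    l.foldl (scanStep P q) s = l.foldl (scanStep P' q) s := by
  induction l generalizing s with
  | nil => rfl
  | cons j l ih =>
    rw [List.mem_cons, not_or] at hl
    have hj : j ≠ i := Ne.symm hl.1
    have hstep : scanStep P q s j = scanStep P' q s j := by
      unfold scanStep; rw [h s.1 hs, h j hj]
    rw [List.foldl_cons, List.foldl_cons, ← hstep]
    refine ih hl.2 _ ?_
    unfold scanStep
    split_ifs <;> assumption

/-- The walk does not depend on the position of the vertex that it ignores. -/
theorem walkEnd_congr_of_ne {α : ℝ} {P P' : Fin n → Pt d} {q : Pt d} {i s : Fin n} (hs : s ≠ i)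
    (h : ∀ j ≠ i, P j = P' j) : walkEnd α P q i s = walkEnd α P' q i s := by
  have hscan : ∀ p ≠ i, scan P (fun j => (buckets α P Finset.univ j).erase i) q p =
      scan P' (fun j => (buckets α P' Finset.univ j).erase i) q p := by
    intro p hp
    have hB : (buckets α P Finset.univ p).erase i = (buckets α P' Finset.univ p).erase i := by
      ext k
      simp only [Finset.mem_erase, mem_buckets_univ]
      refine and_congr_right fun hk => ?_
      rw [h p hp, h k hk]
    unfold scan
    simp only [hB]
    exact foldl_scanStep_congr_of_ne h q _ (by simp) _ hp
  have key : ∀ (m : ℕ) (p : Fin n), p ≠ i →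
      passes P (fun j => (buckets α P Finset.univ j).erase i) q m p =
        passes P' (fun j => (buckets α P' Finset.univ j).erase i) q m p := by
    intro m
    induction m with
    | zero => intro p _; rfl
    | succ m ih =>
      intro p hp
      have hne : (scan P (fun j => (buckets α P Finset.univ j).erase i) q p).1 ≠ i :=
        passes_ne (m := 1) (fun j => Finset.notMem_erase i _) hp
      rw [passes_succ, passes_succ, ih _ hne, hscan p hp]
  exact key _ s hs

theorem walkEnd_ne {α : ℝ} {P : Fin n → Pt d} {q : Pt d} {i s : Fin n} (hs : s ≠ i) :
    walkEnd α P q i s ≠ i :=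
  passes_ne (fun _ => Finset.notMem_erase i _) _ hs

/-- The end of the walk is a function of finitely many truth values, each a measurable comparison of
inner products. -/
theorem measurable_walkEnd {X : Type*} [MeasurableSpace X] {P : X → Fin n → Pt d} {q : X → Pt d}
    (hP : Measurable P) (hq : Measurable q) (α : ℝ) (i s : Fin n) :
    Measurable fun x => walkEnd α (P x) (q x) i s := by
  let code : X → (Fin n → Fin n → Prop) × (Fin n → Fin n → Prop) := fun x =>
    (fun j k => α ≤ inner ℝ (P x j) (P x k),
      fun j k => inner ℝ (P x j) (q x) + 1 / (d : ℝ) ≤ inner ℝ (P x k) (q x))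
  have hPj (j) : Measurable fun x => P x j := (measurable_pi_apply j).comp hP
  have hcode : Measurable code := by
    refine Measurable.prodMk ?_ ?_
    · refine measurable_pi_iff.2 fun j => measurable_pi_iff.2 fun k => ?_
      exact measurableSet_setOfPred.1 (measurableSet_le measurable_const ((hPj j).inner (hPj k)))
    · refine measurable_pi_iff.2 fun j => measurable_pi_iff.2 fun k => ?_
      exact measurableSet_setOfPred.1 (measurableSet_le
        (((hPj j).inner hq).add_const _) ((hPj k).inner hq))
  refine measurable_to_countable' fun e => ?_
  have : (fun x => walkEnd α (P x) (q x) i s) ⁻¹' {e} =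
      code ⁻¹' (code '' ((fun x => walkEnd α (P x) (q x) i s) ⁻¹' {e})) := by
    refine (Set.subset_preimage_image _ _).antisymm ?_
    rintro x ⟨y, hy, hxy⟩
    rw [Set.mem_preimage, ← Set.mem_singleton_iff.1 hy]
    have h1 : ∀ j k, _ := fun j k => congrFun (congrFun (congrArg Prod.fst hxy) j) k
    have h2 : ∀ j k, _ := fun j k => congrFun (congrFun (congrArg Prod.snd hxy) j) k
    exact walkEnd_congr (fun j k => (iff_of_eq (h1 j k)).symm)
      (fun j k => (iff_of_eq (h2 j k)).symm) s
  rw [this]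
  exact hcode (Set.toFinite _).measurableSet

/-- The data for which the end of the walk is unusually far from `p`. -/
def farEnd (α γ η : ℝ) (p q : Pt d) (i s : Fin n) : Set (Fin n → Sph d) :=
  {D | inner ℝ (D (walkEnd α (fun k => (D k : Pt d)) q i s) : Pt d) p <
    γ * inner ℝ (D (walkEnd α (fun k => (D k : Pt d)) q i s) : Pt d) q - η}

theorem measurable_apply_walkEnd {X : Type*} [MeasurableSpace X] {D : X → Fin n → Sph d}
    {q : X → Pt d} (hD : Measurable D) (hq : Measurable q) (α : ℝ) (i s : Fin n) :
    Measurable fun x => (D x (walkEnd α (fun k => (D x k : Pt d)) (q x) i s) : Pt d) := by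
  have h1 : Measurable fun x => walkEnd α (fun k => (D x k : Pt d)) (q x) i s :=
    measurable_walkEnd (by fun_prop) hq α i s
  have h2 : Measurable fun y : (Fin n → Sph d) × Fin n => (y.1 y.2 : Pt d) :=
    measurable_from_prod_countable_left fun e => by fun_prop
  exact h2.comp (hD.prodMk h1)

theorem measurableSet_farEnd {X : Type*} [MeasurableSpace X] {D : X → Fin n → Sph d}
    {p q : X → Pt d} (hD : Measurable D) (hp : Measurable p) (hq : Measurable q) (α γ η : ℝ)
    (i s : Fin n) : MeasurableSet {x | D x ∈ farEnd α γ η (p x) (q x) i s} := by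
  have h := measurable_apply_walkEnd hD hq α i s
  exact measurableSet_lt (h.inner hp) (((h.inner hq).const_mul γ).sub_const η)

/-- An isometry that fixes q and takes p to p' preserves the law of the data and every comparison
that the walk makes. -/
theorem pi_farEnd_eq (hd : 0 < d) (α γ η : ℝ) {p p' q : Pt d} (hp : ‖p‖ = ‖p'‖)
    (h : inner ℝ p q = (inner ℝ p' q : ℝ)) (i s : Fin n) :
    Measure.pi (fun _ => uniformSphere d) (farEnd α γ η p q i s) =
      Measure.pi (fun _ => uniformSphere d) (farEnd α γ η p' q i s) := by
  obtain ⟨T, hT, hTq⟩ := exists_isometry_fixing hp h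
  have hm := measurableSet_farEnd (D := fun D : Fin n → Sph d => D) (p := fun _ => p')
    (q := fun _ => q) measurable_id measurable_const measurable_const α γ η i s
  rw [← (measurePreserving_pi_sphereMap hd T).measure_preimage
    (s := farEnd α γ η p' q i s) hm.nullMeasurableSet]
  congr 1
  ext D
  have hq : ∀ x : Pt d, inner ℝ (T x) q = (inner ℝ x q : ℝ) := fun x => by
    conv_lhs => rw [← hTq]
    exact T.inner_map_map x q
  have hp' : ∀ x : Pt d, inner ℝ (T x) p' = (inner ℝ x p : ℝ) := fun x => by
    rw [← hT]; exact T.inner_map_map x p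
  have hw : walkEnd α (fun k => T (D k : Pt d)) q i s = walkEnd α (fun k => (D k : Pt d)) q i s :=
    walkEnd_congr (fun j k => by rw [T.inner_map_map]) (fun j k => by rw [hq, hq]) s
  have hmem : D ∈ (fun (D : Fin n → Sph d) i => sphereMap T (D i)) ⁻¹' farEnd α γ η p' q i s ↔
      inner ℝ (T (D (walkEnd α (fun k => T (D k : Pt d)) q i s) : Pt d)) p' <
        γ * inner ℝ (T (D (walkEnd α (fun k => T (D k : Pt d)) q i s) : Pt d)) q - η := Iff.rfl
  rw [hmem, hw, hq, hp']
  exact Iff.rfl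

/-- With the planted point frozen at p and the direction at v, the query is a fixed vector, while
the other points remain independent and uniform. -/
theorem sampleLaw_le_of_update (hd : 0 < d) (hn : 0 < n)
    {A : Set ((Fin n → Sph d) × Fin n × Sph d × Fin n)}
    (hA : ∀ i s, MeasurableSet {x : (Fin n → Sph d) × Sph d | (x.1, i, x.2, s) ∈ A}) {δ : ENNReal}
    (h : ∀ i p v s,
      Measure.pi (fun _ => uniformSphere d) {D | (Function.update D i p, i, v, s) ∈ A} ≤ δ) :
    sampleLaw d n A ≤ δ := by
  have := isProbabilityMeasure_uniformSphere hd
  refine sampleLaw_le hd hn hA fun i v s => ?_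
  have hm : Measurable fun D : Fin n → Sph d => (D, v) := by fun_prop
  exact pi_le_of_update i (hm (hA i s)) fun p => h i p v s

theorem uniformSphere_abs_cap_le (hd : 0 < d) {t : ℝ} (ht : 0 ≤ t) (ht2 : t ^ 2 ≤ 1 / 2) {e : Pt d}
    (he : ‖e‖ = 1) :
    (uniformSphere d).real {x | t ≤ |inner ℝ (x : Pt d) e|} ≤
      2 * Real.exp (-(d * t ^ 2 / 2)) := by
  have := isProbabilityMeasure_uniformSphere hd
  have h1 := uniformSphere_cap_le hd ht ht2 he
  have h2 := uniformSphere_cap_le hd ht ht2 (e := -e) (by rwa [norm_neg])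
  have hsub : {x : Sph d | t ≤ |inner ℝ (x : Pt d) e|} ⊆
      {x | t ≤ inner ℝ (x : Pt d) e} ∪ {x | t ≤ inner ℝ (x : Pt d) (-e)} := by
    intro x hx
    rcases le_abs.1 (show t ≤ |inner ℝ (x : Pt d) e| from hx) with h | h
    · exact Or.inl h
    · exact Or.inr (by rwa [← inner_neg_right] at h)
  refine (measureReal_mono hsub).trans ((measureReal_union_le _ _).trans ?_)
  linarith

/-- The probability is the same for all p in the slice ⟨p, q⟩ = γ, so p may be replaced by a random
point of the slice that is independent of the data. Once the data are fixed, the end of the walk is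
a fixed unit vector e, and ⟨e, p⟩ is concentrated near γ⟨e, q⟩. -/
theorem pi_farEnd_le (hd : 0 < d) {α γ η : ℝ} (hγ : γ ^ 2 ≤ 1) (hη : 0 < η) (hη1 : η ≤ 1)
    {p q : Pt d} (hp : ‖p‖ = 1) (hq : ‖q‖ = 1) (h : inner ℝ p q = γ) (i s : Fin n)
    (hx : Real.exp (-(d * (η / 4) ^ 2 / 2)) ≤ 1 / 4) :
    Measure.pi (fun _ => uniformSphere d) (farEnd α γ η p q i s) ≤
      ENNReal.ofReal (2 * Real.exp (-(d * (η / 4) ^ 2 / 2))) := by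
  have := isProbabilityMeasure_uniformSphere hd
  set x := Real.exp (-(d * (η / 4) ^ 2 / 2)) with hxdef
  have hη4 : (η / 4) ^ 2 ≤ 1 / 2 := by nlinarith
  -- Restricting to directions nearly orthogonal to q keeps the normalizing factor of the slice
  -- point under control and costs at most half of the measure; this is the factor 2 in the bound.
  set V : Set (Sph d) := {v | |inner ℝ (v : Pt d) q| < η / 4} with hV
  have hVm : MeasurableSet V := measurableSet_lt (by fun_prop) measurable_const
  have hVlarge : 1 / 2 ≤ (uniformSphere d).real V := by
    have h1 := uniformSphere_abs_cap_le hd (t := η / 4) (by positivity) hη4 hq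
    have h2 : {v : Sph d | η / 4 ≤ |inner ℝ (v : Pt d) q|} = Vᶜ := by
      ext v; simp [hV]
    rw [h2, probReal_compl_eq_one_sub hVm] at h1
    linarith
  let Z : Set ((Fin n → Sph d) × Sph d) :=
    {y | y.2 ∈ V ∧ y.1 ∈ farEnd α γ η (plantedQuery γ q y.2) q i s}
  have hZ : MeasurableSet Z := by
    refine (hVm.preimage measurable_snd).inter (measurableSet_farEnd measurable_fst
      (measurable_plantedQuery measurable_const (by fun_prop)) measurable_const α γ η i s)
  -- Integrating over the data first: by symmetry every v in `V` contributes the same probability.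
  have hfib1 : ((Measure.pi fun _ => uniformSphere d).prod (uniformSphere d)) Z =
      Measure.pi (fun _ => uniformSphere d) (farEnd α γ η p q i s) * uniformSphere d V := by
    rw [Measure.prod_apply_symm hZ, ← lintegral_indicator_const hVm]
    refine lintegral_congr fun v => ?_
    by_cases hv : v ∈ V
    · rw [Set.indicator_of_mem hv]
      have hv1 : ‖(v : Pt d)‖ = 1 := by simp
      have hvq : |(inner ℝ q (v : Pt d) : ℝ)| < 1 := by
        have : |inner ℝ (v : Pt d) q| < η / 4 := hv
        rw [real_inner_comm]; linarith
      rw [pi_farEnd_eq hd α γ η (p' := plantedQuery γ q v)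
        (hp.trans (norm_plantedQuery hq hv1 hγ hvq).symm)
        (by rw [h, real_inner_comm, inner_plantedQuery_left hq])]
      congr 1
      ext D
      exact and_iff_right hv
    · rw [Set.indicator_of_notMem hv]
      have : (fun D => (D, v)) ⁻¹' Z = ∅ := by
        ext D
        exact iff_of_false (fun h => hv h.1) id
      rw [this, measure_empty]
  -- Integrating over v first: with e fixed, the event forces v into the cap of height η/4 around
  -- -e. Otherwise ⟨e, v⟩ - ⟨q, v⟩⟨e, q⟩ > -η/2, and dividing by a norm of at least 1/2 still leaves
  -- more than -η.
  have hfib2 : ((Measure.pi fun _ => uniformSphere d).prod (uniformSphere d)) Z ≤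
      ENNReal.ofReal x := by
    rw [Measure.prod_apply hZ]
    refine le_trans (lintegral_mono (g := fun _ => ENNReal.ofReal x) fun D => ?_) (by simp)
    set e : Pt d := (D (walkEnd α (fun k => (D k : Pt d)) q i s) : Sph d).1 with he
    have he1 : ‖e‖ = 1 := by rw [he]; simp
    have hcap := uniformSphere_cap_le hd (t := η / 4) (by positivity) hη4 (e := -e)
      (by rwa [norm_neg])
    refine (measure_mono ?_).trans
      ((ENNReal.le_ofReal_iff_toReal_le (measure_ne_top _ _) (by positivity)).2 hcap)
    rintro v ⟨hv, hD⟩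
    change inner ℝ e (plantedQuery γ q v) < γ * inner ℝ e q - η at hD
    change |inner ℝ (v : Pt d) q| < η / 4 at hv
    change η / 4 ≤ inner ℝ (v : Pt d) (-e)
    rw [inner_neg_right, real_inner_comm e]
    have hv1 : ‖(v : Pt d)‖ = 1 := by simp
    have hβ : |inner ℝ e q| ≤ 1 := by
      have := abs_real_inner_le_norm e q
      rwa [he1, hq, one_mul] at this
    have hN := norm_sub_inner_smul_sq hq hv1
    rw [plantedQuery] at hD
    simp only [inner_add_right, inner_sub_right, real_inner_smul_right] at hD
    set N := ‖(v : Pt d) - (inner ℝ q (v : Pt d) : ℝ) • q‖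
    rw [real_inner_comm q v] at hv
    have hv' : (inner ℝ q (v : Pt d) : ℝ) ^ 2 < 1 / 4 := by
      rw [← sq_abs]; nlinarith [abs_nonneg (inner ℝ q (v : Pt d) : ℝ)]
    have hN2 : 1 / 2 ≤ N := by
      by_contra! hcon
      have : 0 ≤ N := norm_nonneg _
      nlinarith
    by_contra! hcon
    set a : ℝ := inner ℝ e (v : Pt d) with ha
    set y : ℝ := inner ℝ q (v : Pt d)
    set β : ℝ := inner ℝ e q
    have hyβ : |y * β| ≤ η / 4 := by
      rw [abs_mul]; nlinarith [abs_nonneg y, abs_nonneg β]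
    have h3 : -(η / 2) < a - y * β := by
      have := (abs_le.1 hyβ).2
      linarith
    have hs1 : √(1 - γ ^ 2) ≤ 1 := Real.sqrt_le_one.2 (by nlinarith [sq_nonneg γ])
    have hs0 : 0 ≤ √(1 - γ ^ 2) := Real.sqrt_nonneg _
    have h4 : -η < N⁻¹ * (a - y * β) := by
      rw [inv_mul_eq_div, lt_div_iff₀ (by linarith)]
      nlinarith
    have h5 : √(1 - γ ^ 2) * (N⁻¹ * (a - y * β)) < -η := by linarith
    rcases le_or_gt 0 (N⁻¹ * (a - y * β)) with h6 | h6
    · linarith [mul_nonneg hs0 h6]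
    · linarith [mul_le_mul_of_nonpos_right hs1 h6.le]
  rw [hfib1] at hfib2
  rw [← ENNReal.ofReal_toReal (measure_ne_top (Measure.pi fun _ => uniformSphere d) _)] at hfib2 ⊢
  rw [← ENNReal.ofReal_toReal (measure_ne_top (uniformSphere d) V),
    ← ENNReal.ofReal_mul ENNReal.toReal_nonneg] at hfib2
  refine ENNReal.ofReal_le_ofReal ?_
  have h7 := (ENNReal.ofReal_le_ofReal_iff (by positivity)).1 hfib2
  change _ * (uniformSphere d).real V ≤ x at h7
  have h8 : 0 ≤ ((Measure.pi fun _ => uniformSphere d) (farEnd α γ η p q i s)).toReal :=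
    ENNReal.toReal_nonneg
  nlinarith

end Planted

/-! ### Asymptotics of sparse data -/

section Asymptotics

variable {n : ℕ → ℕ}

theorem IsSparse.tendsto_log (h : IsSparse n) :
    Tendsto (fun d => Real.log (n d)) atTop atTop := by
  have h1 : Tendsto (fun d : ℕ => Real.log d) atTop atTop :=
    Real.tendsto_log_atTop.comp tendsto_natCast_atTop_atTop
  refine tendsto_atTop_mono' _ ?_ h1
  filter_upwards [h.2.bound one_pos] with d hd
  rw [one_mul, Real.norm_of_nonneg (Real.log_natCast_nonneg _),
    Real.norm_of_nonneg (Real.log_natCast_nonneg _)] at hd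
  exact hd

theorem IsSparse.tendsto (h : IsSparse n) : Tendsto (fun d => (n d : ℝ)) atTop atTop := by
  refine tendsto_atTop_mono (fun d => ?_) h.tendsto_log
  exact Real.log_le_self (Nat.cast_nonneg _)

theorem IsSparse.eventually_const_mul_rpow_le (h : IsSparse n) (C : ℝ) {l m : ℝ} (hlm : l < m) :
    ∀ᶠ d in atTop, C * (n d : ℝ) ^ l ≤ (n d : ℝ) ^ m := by
  have h1 : Tendsto (fun d => (n d : ℝ) ^ (m - l)) atTop atTop :=
    (tendsto_rpow_atTop (sub_pos.2 hlm)).comp h.tendsto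
  filter_upwards [h1.eventually_ge_atTop C, h.tendsto.eventually_gt_atTop 0] with d h2 h3
  have : (n d : ℝ) ^ m = (n d : ℝ) ^ (m - l) * (n d : ℝ) ^ l := by
    rw [← Real.rpow_add h3]; congr 1; ring
  rw [this]
  gcongr

theorem IsSparse.eventually_natCast_le (h : IsSparse n) {ε : ℝ} (hε : 0 < ε) :
    ∀ᶠ d : ℕ in atTop, (d : ℝ) ≤ (n d : ℝ) ^ ε := by
  filter_upwards [h.2.bound hε, eventually_gt_atTop 0, h.tendsto.eventually_gt_atTop 0]
    with d hd hd0 hn0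
  rw [Real.norm_of_nonneg (Real.log_natCast_nonneg _),
    Real.norm_of_nonneg (Real.log_natCast_nonneg _)] at hd
  rw [Real.rpow_def_of_pos hn0, ← Real.log_le_iff_le_exp (by exact_mod_cast hd0)]
  linarith

theorem IsSparse.tendsto_rpow_neg (h : IsSparse n) {s : ℝ} (hs : 0 < s) :
    Tendsto (fun d => (n d : ℝ) ^ (-s)) atTop (𝓝 0) :=
  (tendsto_rpow_neg_atTop hs).comp h.tendsto

/-- The form in which the union bounds over the n points are used. -/
theorem IsSparse.tendsto_mul_exp_neg (h : IsSparse n) {s C : ℝ} (hs : 0 < s) (hC : 0 < C) :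
    Tendsto (fun d => (n d : ℝ) * Real.exp (-(C * (n d : ℝ) ^ s))) atTop (𝓝 0) := by
  have h1 := (tendsto_rpow_mul_exp_neg_mul_atTop_nhds_zero (1 / s) C hC).comp
    ((tendsto_rpow_atTop hs).comp h.tendsto)
  refine h1.congr fun d => ?_
  simp only [Function.comp_apply]
  rw [← Real.rpow_mul (Nat.cast_nonneg _), mul_one_div_cancel hs.ne', Real.rpow_one, neg_mul]

/-! ### The scale μ and the measure of caps at this scale. -/

theorem one_sub_muParam_sq {d m : ℕ} (hm : 0 < m) :
    1 - muParam d m ^ 2 = (m : ℝ) ^ (-(2 : ℝ) / d) := by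
  have h1 : (m : ℝ) ^ (-(2 : ℝ) / d) ≤ 1 :=
    Real.rpow_le_one_of_one_le_of_nonpos (by exact_mod_cast hm)
      (div_nonpos_of_nonpos_of_nonneg (by norm_num) (Nat.cast_nonneg _))
  rw [muParam, Real.sq_sqrt (by linarith)]
  ring

theorem muParam_nonneg (d m : ℕ) : 0 ≤ muParam d m := Real.sqrt_nonneg _

theorem one_sub_muParam_sq_eq_exp {d m : ℕ} (hm : 0 < m) :
    1 - muParam d m ^ 2 = Real.exp (-(2 * (Real.log m / d))) := by
  rw [one_sub_muParam_sq hm, Real.rpow_def_of_pos (by exact_mod_cast hm)]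
  congr 1
  ring

theorem muParam_le_one {d m : ℕ} (hm : 0 < m) : muParam d m ≤ 1 := by
  have h := one_sub_muParam_sq_eq_exp (d := d) hm
  have := Real.exp_pos (-(2 * (Real.log m / d)))
  nlinarith [muParam_nonneg d m]

theorem IsSparse.tendsto_log_div (h : IsSparse n) :
    Tendsto (fun d : ℕ => Real.log (n d) / d) atTop (𝓝 0) := h.1.tendsto_div_nhds_zero

theorem IsSparse.eventually_pos (h : IsSparse n) : ∀ᶠ d in atTop, 0 < n d := by
  filter_upwards [h.tendsto.eventually_gt_atTop 0] with d hd
  exact_mod_cast hd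

theorem IsSparse.tendsto_muParam (h : IsSparse n) :
    Tendsto (fun d => muParam d (n d)) atTop (𝓝 0) := by
  have h1 : Tendsto (fun d : ℕ => 1 - Real.exp (-(2 * (Real.log (n d) / d)))) atTop (𝓝 0) := by
    have := (Real.continuous_exp.tendsto _).comp ((h.tendsto_log_div.const_mul 2).neg)
    simpa using this.const_sub 1
  have h2 := (Real.continuous_sqrt.tendsto _).comp h1
  rw [Real.sqrt_zero] at h2
  refine h2.congr' ?_
  filter_upwards [h.eventually_pos] with d hd
  simp only [Function.comp_apply]
  rw [← one_sub_muParam_sq_eq_exp hd, sub_sub_cancel, Real.sqrt_sq (muParam_nonneg _ _)]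

theorem IsSparse.eventually_log_le (h : IsSparse n) {ε : ℝ} (hε : 0 < ε) :
    ∀ᶠ d in atTop, (1 - ε) * Real.log (n d) ≤ d * muParam d (n d) ^ 2 / 2 := by
  filter_upwards [h.eventually_pos, eventually_gt_atTop 0,
    h.tendsto_log_div.eventually_lt_const (show 0 < min ε 1 / 2 by positivity)]
    with d hn hd hlog
  set L := Real.log (n d) with hL
  have hL0 : 0 ≤ L := Real.log_natCast_nonneg _
  have hd' : (0 : ℝ) < d := by exact_mod_cast hd
  set y := L / d with hy
  have hy0 : 0 ≤ y := by positivity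
  have hLy : L = y * d := by rw [hy]; field_simp
  have hμ := one_sub_muParam_sq_eq_exp (d := d) hn
  rw [← hL, ← hy] at hμ
  -- For z ≥ 0, exp(-z) ≤ 1/(1 + z) ≤ 1 - z + z², since (1 + z)(1 - z + z²) = 1 + z³.
  have hexp : Real.exp (-(2 * y)) ≤ 1 - 2 * y + (2 * y) ^ 2 := by
    have h1 := Real.add_one_le_exp (2 * y)
    rw [Real.exp_neg, inv_le_comm₀ (Real.exp_pos _) (by nlinarith [sq_nonneg (2 * y - 1)])]
    refine le_trans ?_ h1
    rw [inv_le_iff_one_le_mul₀ (by nlinarith [sq_nonneg (2 * y - 1)])]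
    nlinarith [pow_nonneg hy0 3]
  have hyε : 2 * y ≤ ε := by linarith [min_le_left ε 1]
  have : 2 * y * (1 - ε) ≤ muParam d (n d) ^ 2 := by nlinarith
  rw [hLy]
  nlinarith

theorem IsSparse.eventually_exp_le (h : IsSparse n) {s ε : ℝ} (hε : 0 < ε) :
    ∀ᶠ d in atTop, Real.exp (-(d * (s * muParam d (n d)) ^ 2 / 2)) ≤
      (n d : ℝ) ^ (-(s ^ 2 * (1 - ε))) := by
  filter_upwards [h.eventually_log_le hε, h.eventually_pos] with d h1 hn
  rw [Real.rpow_def_of_pos (by exact_mod_cast hn)]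
  refine Real.exp_le_exp.2 ?_
  nlinarith [mul_le_mul_of_nonneg_left h1 (sq_nonneg s)]

theorem IsSparse.eventually_muParam_le (h : IsSparse n) {ε : ℝ} (hε : 0 < ε) :
    ∀ᶠ d in atTop, muParam d (n d) ≤ ε :=
  (h.tendsto_muParam.eventually_lt_const hε).mono fun _ => le_of_lt

/-- As μ ≤ 1, dμ ≥ dμ² ≥ log n → ∞. So the improvement 1/d required of a replacement is negligible
on the scale μ. -/
theorem IsSparse.eventually_inv_le (h : IsSparse n) {ε : ℝ} (hε : 0 < ε) :
    ∀ᶠ d : ℕ in atTop, 1 / (d : ℝ) ≤ ε * muParam d (n d) := by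
  filter_upwards [h.eventually_log_le (show (0 : ℝ) < 1 / 2 by norm_num), h.eventually_pos,
    eventually_gt_atTop 0, h.tendsto_log.eventually_ge_atTop (1 / ε)] with d h1 hn hd hL
  have hd' : (0 : ℝ) < d := by exact_mod_cast hd
  have h2 := muParam_le_one (d := d) hn
  have h3 := muParam_nonneg d (n d)
  have h4 : 1 / ε ≤ d * muParam d (n d) := by
    have : (d : ℝ) * muParam d (n d) ^ 2 ≤ d * muParam d (n d) := by
      gcongr
      nlinarith
    linarith
  rw [div_le_iff₀ hε] at h4
  rw [div_le_iff₀ hd']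
  linarith

theorem IsSparse.eventually_muParam_pos (h : IsSparse n) :
    ∀ᶠ d in atTop, 0 < muParam d (n d) := by
  filter_upwards [h.eventually_inv_le one_pos, eventually_gt_atTop 0] with d h1 hd
  have : (0 : ℝ) < 1 / d := by positivity
  linarith

/-- The measure of the intersection of two caps around nearly orthogonal vectors. -/
theorem IsSparse.eventually_le_wedge (h : IsSparse n) {κ b ε : ℝ} (hκ : 0 ≤ κ) (hκ1 : κ ≤ 1)
    (hb : 0 ≤ b) (hb1 : b ≤ 1) (hε : 0 < ε) (hε1 : ε ≤ 1) (hθ : κ ^ 2 + b ^ 2 + 50 * ε ≤ 1) :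
    ∀ᶠ d in atTop, ∀ x q : Pt d, ‖x‖ = 1 → ‖q‖ = 1 →
      |(inner ℝ x q : ℝ)| ≤ 2 * muParam d (n d) →
      (n d : ℝ) ^ (-(κ ^ 2 + b ^ 2 + 50 * ε)) / 2 ≤ (uniformSphere d).real
        {z | κ * muParam d (n d) ≤ inner ℝ (z : Pt d) x ∧
          b * muParam d (n d) + 1 / d ≤ inner ℝ (z : Pt d) q} := by
  have hexp : Tendsto (fun d => (n d : ℝ) ^ (-(ε ^ 2 * (1 - 1 / 2)))) atTop (𝓝 0) :=
    h.tendsto_rpow_neg (by positivity)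
  filter_upwards [h.eventually_inv_le hε, h.eventually_muParam_le (show 0 < ε / 8 by positivity),
    h.eventually_pos, eventually_gt_atTop 0,
    h.eventually_exp_le (s := ε) (show (0 : ℝ) < 1 / 2 by norm_num),
    hexp.eventually_lt_const (show (0 : ℝ) < 1 / 8 by norm_num)]
    with d hinv hμ hn hd hexp1 hexp2 x q hx hq hxq
  set μ := muParam d (n d) with hμdef
  set θ := κ ^ 2 + b ^ 2 + 50 * ε with hθdef
  have hθ0 : 0 ≤ θ := by positivity
  have hμ0 : 0 ≤ μ := muParam_nonneg _ _
  have hμ1 : μ ^ 2 ≤ 1 := by nlinarith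
  have hd' : (0 : ℝ) < d := by exact_mod_cast hd
  have hn' : (0 : ℝ) < n d := by exact_mod_cast hn
  set g : ℝ := inner ℝ x q with hg
  have hg1 := abs_le.1 hxq
  have hinv0 : 0 ≤ 1 / (d : ℝ) := by positivity
  -- The surplus 2εμ and 3εμ in the coefficients pays for τ = εμ, for 1/d ≤ εμ in the second height,
  -- and for the cross terms, which are at most 8μ² ≤ εμ.
  have key := le_uniformSphere_wedge hd hx hq (α := κ * μ) (β := b * μ + 1 / d)
    (a := (κ + 2 * ε) * μ) (b := (b + 3 * ε) * μ) (τ := ε * μ) (r := √(1 - θ * μ ^ 2))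
    (by positivity) (by positivity) (by positivity) (by positivity) (by positivity)
    (Real.sqrt_nonneg _) ?_ ?_ ?_
  · refine le_trans ?_ key
    -- Bernoulli's inequality (1 - μ²)^θ ≤ 1 - θμ² for θ ≤ 1, together with (1 - μ²)^(d/2) = 1/n.
    have hr : (n d : ℝ) ^ (-θ) ≤ √(1 - θ * μ ^ 2) ^ d := by
      have h1 : ((n d : ℝ) ^ (-θ / d)) ^ d = (n d : ℝ) ^ (-θ) := by
        rw [← Real.rpow_natCast, ← Real.rpow_mul hn'.le, div_mul_cancel₀ _ hd'.ne']
      rw [← h1]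
      gcongr
      refine Real.le_sqrt_of_sq_le ?_
      have h2 : ((n d : ℝ) ^ (-θ / d)) ^ 2 = (1 + -μ ^ 2) ^ θ := by
        rw [← sub_eq_add_neg, one_sub_muParam_sq hn, ← Real.rpow_mul hn'.le, ← Real.rpow_natCast,
          ← Real.rpow_mul hn'.le]
        congr 1
        push_cast
        ring
      rw [h2]
      refine (rpow_one_add_le_one_add_mul_self (by linarith) hθ0 hθ).trans (le_of_eq (by ring))
    have h3 : (1 : ℝ) / 2 ≤ 1 - 4 * Real.exp (-(d * (ε * μ) ^ 2 / 2)) := by linarith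
    calc (n d : ℝ) ^ (-θ) / 2 = (n d : ℝ) ^ (-θ) * (1 / 2) := by ring
      _ ≤ _ := by gcongr
  · have : (b + 3 * ε) * g ≥ -(8 * μ) := by nlinarith
    nlinarith
  · have : (κ + 2 * ε) * g ≥ -(6 * μ) := by nlinarith
    nlinarith
  · have hθμ : 0 ≤ 1 - θ * μ ^ 2 := by nlinarith
    rw [Real.sq_sqrt hθμ]
    have e1 : ((κ + 2 * ε) * μ) ^ 2 ≤ (κ ^ 2 + 8 * ε) * μ ^ 2 := by
      rw [mul_pow]; gcongr; nlinarith
    have e2 : ((b + 3 * ε) * μ) ^ 2 ≤ (b ^ 2 + 15 * ε) * μ ^ 2 := by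
      rw [mul_pow]; gcongr; nlinarith
    have e3 : 2 * ((κ + 2 * ε) * μ) * ((b + 3 * ε) * μ) * g ≤ 6 * ε * μ ^ 2 := by
      have f0 : 0 ≤ (κ + 2 * ε) * (b + 3 * ε) := by positivity
      have f1 : (κ + 2 * ε) * (b + 3 * ε) ≤ 3 * 4 := by gcongr <;> linarith
      have f2 : (κ + 2 * ε) * (b + 3 * ε) * g ≤ 3 * ε :=
        calc _ ≤ (κ + 2 * ε) * (b + 3 * ε) * (ε / 4) := by gcongr; linarith
          _ ≤ 3 * 4 * (ε / 4) := by gcongr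
          _ = 3 * ε := by ring
      calc _ = 2 * ((κ + 2 * ε) * (b + 3 * ε) * g) * μ ^ 2 := by ring
        _ ≤ 2 * (3 * ε) * μ ^ 2 := by gcongr
        _ = _ := by ring
    have e4 : 2 * ((κ + 2 * ε) * μ + (b + 3 * ε) * μ) * (ε * μ) ≤ 14 * ε * μ ^ 2 := by
      calc _ = 2 * (κ + b + 5 * ε) * (ε * μ ^ 2) := by ring
        _ ≤ 2 * 7 * (ε * μ ^ 2) := by gcongr; linarith
        _ = _ := by ring
    -- The errors 8 + 15 + 6 + 14 = 43 stay below the 50 reserved in θ.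
    have e5 : (1 - (κ ^ 2 + b ^ 2 + 50 * ε) * μ ^ 2) + (κ ^ 2 + 8 * ε) * μ ^ 2 +
        (b ^ 2 + 15 * ε) * μ ^ 2 + 6 * ε * μ ^ 2 + 14 * ε * μ ^ 2 = 1 - 7 * (ε * μ ^ 2) := by ring
    have : 0 ≤ ε * μ ^ 2 := by positivity
    linarith

end Asymptotics

/-! ### Exceptional events of small probability -/

section Events

variable {n : ℕ → ℕ}

theorem tendsto_zero_of_le_ofReal {f : ℕ → ENNReal} {g : ℕ → ℝ}
    (h : ∀ᶠ d in atTop, f d ≤ ENNReal.ofReal (g d)) (hg : Tendsto g atTop (𝓝 0)) :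
    Tendsto f atTop (𝓝 0) := by
  have h1 := ENNReal.tendsto_ofReal hg
  rw [ENNReal.ofReal_zero] at h1
  exact tendsto_of_tendsto_of_tendsto_of_le_of_le' tendsto_const_nhds h1
    (Eventually.of_forall fun _ => zero_le) h

theorem measure_le_of_subset_iUnion {X : Type*} [MeasurableSpace X] {m : Measure X} {k : ℕ}
    {A : Set X} {U : Fin k → Set X} (hA : A ⊆ ⋃ j, U j) {t : ℝ}
    (hU : ∀ j, m (U j) ≤ ENNReal.ofReal t) : m A ≤ ENNReal.ofReal (k * t) := by
  calc m A ≤ ∑ j, m (U j) := (measure_mono hA).trans (measure_iUnion_fintype_le m U)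
    _ ≤ ∑ _j : Fin k, ENNReal.ofReal t := Finset.sum_le_sum fun j _ => hU j
    _ = _ := by
      rw [Finset.sum_const, Finset.card_univ, Fintype.card_fin, nsmul_eq_mul,
        ENNReal.ofReal_mul (Nat.cast_nonneg _), ENNReal.ofReal_natCast]

theorem pi_eval_abs_le {d k : ℕ} (hd : 0 < d) (j : Fin k) {t : ℝ} (ht : 0 ≤ t)
    (ht2 : t ^ 2 ≤ 1 / 2) {e : Pt d} (he : ‖e‖ = 1) :
    Measure.pi (fun _ => uniformSphere d) {D : Fin k → Sph d | t ≤ |inner ℝ (D j : Pt d) e|} ≤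
      ENNReal.ofReal (2 * Real.exp (-(d * t ^ 2 / 2))) := by
  have := isProbabilityMeasure_uniformSphere hd
  have hm : MeasurableSet {x : Sph d | t ≤ |inner ℝ (x : Pt d) e|} :=
    measurableSet_le measurable_const (by fun_prop)
  have h1 := (measurePreserving_eval (fun _ : Fin k => uniformSphere d) j).measure_preimage
    hm.nullMeasurableSet
  refine (le_of_eq h1).trans ?_
  exact (ENNReal.le_ofReal_iff_toReal_le (measure_ne_top _ _) (by positivity)).2
    (uniformSphere_abs_cap_le hd ht ht2 he)

theorem IsSparse.tendsto_planted_eq_start (h : IsSparse n) :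
    Tendsto (fun d => sampleLaw d (n d) {x | x.2.1 = x.2.2.2}) atTop (𝓝 0) := by
  refine tendsto_zero_of_le_ofReal (g := fun d => (n d : ℝ)⁻¹) ?_
    (tendsto_inv_atTop_zero.comp h.tendsto)
  filter_upwards [h.eventually_pos, eventually_gt_atTop 0] with d hn hd
  refine (sampleLaw_planted_eq_start hd hn).trans (le_of_eq ?_)
  rw [ENNReal.ofReal_inv_of_pos (by exact_mod_cast hn), ENNReal.ofReal_natCast]

/-- Serves only to make the query a unit vector outside an event of small probability. -/
theorem IsSparse.tendsto_dir (h : IsSparse n) :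
    Tendsto (fun d => sampleLaw d (n d)
      {x | 1 / 2 ≤ |inner ℝ (x.1 x.2.1 : Pt d) (x.2.2.1 : Pt d)|}) atTop (𝓝 0) := by
  have hlim : Tendsto (fun d : ℕ => 2 * Real.exp (-((d : ℝ) * (1 / 2) ^ 2 / 2))) atTop (𝓝 0) := by
    have h1 : Tendsto (fun d : ℕ => (d : ℝ) * ((1 / 2) ^ 2 / 2)) atTop atTop :=
      tendsto_natCast_atTop_atTop.atTop_mul_const (by norm_num)
    have h2 := (Real.tendsto_exp_neg_atTop_nhds_zero.comp h1).const_mul 2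
    rw [mul_zero] at h2
    refine h2.congr fun d => ?_
    simp only [Function.comp_apply, mul_div_assoc]
  refine tendsto_zero_of_le_ofReal ?_ hlim
  filter_upwards [h.eventually_pos, eventually_gt_atTop 0] with d hn hd
  refine sampleLaw_le hd hn (fun i s => ?_) fun i v s => ?_
  · change MeasurableSet {x : (Fin (n d) → Sph d) × Sph d |
      1 / 2 ≤ |inner ℝ (x.1 i : Pt d) (x.2 : Pt d)|}
    exact measurableSet_le measurable_const (by fun_prop)
  · change Measure.pi (fun _ => uniformSphere d) {D : Fin (n d) → Sph d |
      1 / 2 ≤ |inner ℝ (D i : Pt d) (v : Pt d)|} ≤ _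
    exact pi_eval_abs_le hd i (t := 1 / 2) (by norm_num) (by norm_num) (by simp)

theorem measurableSet_dir {d k : ℕ} (i : Fin k) : MeasurableSet
    {x : (Fin k → Sph d) × Sph d | |(inner ℝ (x.1 i : Pt d) (x.2 : Pt d) : ℝ)| < 1 / 2} :=
  measurableSet_lt (by fun_prop) measurable_const

theorem measurable_query {d k : ℕ} (γ : ℝ) (i : Fin k) :
    Measurable fun x : (Fin k → Sph d) × Sph d => plantedQuery γ (x.1 i : Pt d) (x.2 : Pt d) :=
  measurable_plantedQuery (by fun_prop) (by fun_prop)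

theorem norm_query {d : ℕ} {γ : ℝ} (hγ : γ ^ 2 ≤ 1) {p v : Sph d}
    (h : |(inner ℝ (p : Pt d) (v : Pt d) : ℝ)| < 1 / 2) :
    ‖plantedQuery γ (p : Pt d) (v : Pt d)‖ = 1 :=
  norm_plantedQuery (by simp) (by simp) hγ (by linarith)

/-- For a frozen query, each other point has height at least 2μ in absolute value with probability
at most 2n⁻², which survives the union over n points. -/
theorem IsSparse.tendsto_height (h : IsSparse n) {γ : ℝ} (hγ : γ ^ 2 ≤ 1) :
    Tendsto (fun d => sampleLaw d (n d)
      {x | |(inner ℝ (x.1 x.2.1 : Pt d) (x.2.2.1 : Pt d) : ℝ)| < 1 / 2 ∧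
        ∃ j ≠ x.2.1, 2 * muParam d (n d) ≤
          |inner ℝ (x.1 j : Pt d) (plantedQuery γ (x.1 x.2.1 : Pt d) (x.2.2.1 : Pt d))|})
      atTop (𝓝 0) := by
  have hlim : Tendsto (fun d => 2 * (n d : ℝ) ^ (-(1 : ℝ))) atTop (𝓝 0) := by
    simpa using (h.tendsto_rpow_neg one_pos).const_mul 2
  refine tendsto_zero_of_le_ofReal ?_ hlim
  filter_upwards [h.eventually_pos, eventually_gt_atTop 0,
    h.eventually_exp_le (s := 2) (show (0 : ℝ) < 1 / 2 by norm_num),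
    h.eventually_muParam_le (show (0 : ℝ) < 1 / 3 by norm_num)] with d hn hd hexp hμ
  have hμ0 := muParam_nonneg d (n d)
  refine sampleLaw_le_of_update hd hn (fun i s => ?_) fun i p v s => ?_
  · refine (measurableSet_dir i).inter (MeasurableSet.congr (MeasurableSet.iUnion fun j =>
      MeasurableSet.iUnion fun (_ : j ≠ i) => measurableSet_le (f := fun _ => 2 * muParam d (n d))
        (g := fun x : (Fin (n d) → Sph d) × Sph d =>
          |inner ℝ (x.1 j : Pt d) (plantedQuery γ (x.1 i : Pt d) (x.2 : Pt d))|)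
        measurable_const ?_) ?_)
    · have := measurable_query (d := d) γ i
      fun_prop
    · ext x
      simp only [Set.mem_iUnion, exists_prop]
      rfl
  · by_cases hv : |(inner ℝ (p : Pt d) (v : Pt d) : ℝ)| < 1 / 2
    swap
    · refine (measure_mono_null (t := ∅) (fun D hD => hv ?_) measure_empty).le.trans zero_le
      have h1 : |(inner ℝ (Function.update D i p i : Pt d) (v : Pt d) : ℝ)| < 1 / 2 := hD.1
      rwa [Function.update_self] at h1
    refine (measure_le_of_subset_iUnion (U := fun j => {D : Fin (n d) → Sph d |
      2 * muParam d (n d) ≤ |inner ℝ (D j : Pt d) (plantedQuery γ (p : Pt d) (v : Pt d))|}) ?_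
      fun j => pi_eval_abs_le hd j (by positivity) (by nlinarith) (norm_query hγ hv)).trans
      (ENNReal.ofReal_le_ofReal ?_)
    · rintro D ⟨-, j, hj, hD⟩
      simp only [Function.update_of_ne hj, Function.update_self] at hD
      exact Set.mem_iUnion.2 ⟨j, hD⟩
    · have hn' : (0 : ℝ) < n d := by exact_mod_cast hn
      have e1 : (n d : ℝ) ^ (-(2 ^ 2 * (1 - 1 / 2)) : ℝ) = (n d : ℝ) ^ (-(1 : ℝ)) * (n d : ℝ)⁻¹ := by
        rw [← Real.rpow_neg_one, ← Real.rpow_add hn']; norm_num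
      calc (n d : ℝ) * (2 * Real.exp (-(d * (2 * muParam d (n d)) ^ 2 / 2)))
          ≤ n d * (2 * ((n d : ℝ) ^ (-(1 : ℝ)) * (n d : ℝ)⁻¹)) := by rw [← e1]; gcongr
        _ = _ := by field_simp

theorem IsSparse.tendsto_farEnd (h : IsSparse n) {γ δ : ℝ} (hγ : γ ^ 2 ≤ 1) (hδ : 0 < δ)
    (α : ℕ → ℝ) :
    Tendsto (fun d => sampleLaw d (n d)
      {x | |(inner ℝ (x.1 x.2.1 : Pt d) (x.2.2.1 : Pt d) : ℝ)| < 1 / 2 ∧ x.2.2.2 ≠ x.2.1 ∧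
        x.1 ∈ farEnd (α d) γ (δ * muParam d (n d)) (x.1 x.2.1 : Pt d)
          (plantedQuery γ (x.1 x.2.1 : Pt d) (x.2.2.1 : Pt d)) x.2.1 x.2.2.2})
      atTop (𝓝 0) := by
  have hexp0 := h.tendsto_rpow_neg (show 0 < (δ / 4) ^ 2 * (1 - 1 / 2) by positivity)
  have hlim := hexp0.const_mul 2
  rw [mul_zero] at hlim
  refine tendsto_zero_of_le_ofReal ?_ hlim
  filter_upwards [h.eventually_pos, eventually_gt_atTop 0,
    h.eventually_exp_le (s := δ / 4) (show (0 : ℝ) < 1 / 2 by norm_num),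
    h.eventually_muParam_le (show (0 : ℝ) < 1 / δ by positivity), h.eventually_muParam_pos,
    hexp0.eventually_lt_const (show (0 : ℝ) < 1 / 4 by norm_num)]
    with d hn hd hexp hμ hμ0 hexp1
  have e0 : δ * muParam d (n d) / 4 = δ / 4 * muParam d (n d) := by ring
  refine sampleLaw_le_of_update hd hn (fun i s => ?_) fun i p v s => ?_
  · refine (measurableSet_dir i).inter (MeasurableSet.inter (MeasurableSet.const (s ≠ i)) ?_)
    exact measurableSet_farEnd (p := fun x : (Fin (n d) → Sph d) × Sph d => (x.1 i : Pt d))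
      measurable_fst (by fun_prop) (measurable_query γ i) _ _ _ i s
  · by_cases hv : |(inner ℝ (p : Pt d) (v : Pt d) : ℝ)| < 1 / 2
    swap
    · refine (measure_mono_null (t := ∅) (fun D hD => hv ?_) measure_empty).le.trans zero_le
      have h1 : |(inner ℝ (Function.update D i p i : Pt d) (v : Pt d) : ℝ)| < 1 / 2 := hD.1
      rwa [Function.update_self] at h1
    by_cases hs : s ≠ i
    swap
    · exact (measure_mono_null (t := ∅) (fun D hD => hs hD.2.1) measure_empty).le.trans zero_le
    have hq := norm_query hγ hv
    refine (measure_mono ?_).trans ((pi_farEnd_le (α := α d) (γ := γ) (η := δ * muParam d (n d)) hd hγ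
      (by positivity) ?_ (p := p) (q := plantedQuery γ (p : Pt d) (v : Pt d)) (by simp) hq
      (inner_plantedQuery_left (by simp) _ _) i s ?_).trans (ENNReal.ofReal_le_ofReal ?_))
    -- The walk neither sees nor ends at the planted point, so the frozen coordinate can be made an
    -- ordinary uniform point again.
    · rintro D ⟨-, -, hD⟩
      simp only [Function.update_self] at hD
      have hw := walkEnd_congr_of_ne (α := α d)
        (P := fun k => (Function.update D i p k : Pt d)) (P' := fun k => (D k : Pt d))
        (q := plantedQuery γ (p : Pt d) (v : Pt d)) hs
        (fun j hj => by rw [Function.update_of_ne hj])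
      have hne := walkEnd_ne (α := α d) (P := fun k => (D k : Pt d))
        (q := plantedQuery γ (p : Pt d) (v : Pt d)) hs
      unfold farEnd at hD ⊢
      rw [Set.mem_ofPred_eq, hw, Function.update_of_ne hne] at hD
      exact hD
    · have := mul_le_mul_of_nonneg_left hμ hδ.le
      rwa [mul_one_div_cancel hδ.ne'] at this
    · rw [e0]; linarith
    · rw [e0]; linarith

theorem measurableSet_pair_cap {d : ℕ} (α : ℝ) : MeasurableSet
    {x : Sph d × Sph d | x.2 ∈ {z : Sph d | α ≤ inner ℝ (z : Pt d) (x.1 : Pt d)}} := by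
  change MeasurableSet {x : Sph d × Sph d | α ≤ inner ℝ (x.2 : Pt d) (x.1 : Pt d)}
  exact measurableSet_le measurable_const (by fun_prop)

theorem measurableSet_wedge {d : ℕ} (α β : ℝ) (q : Pt d) : MeasurableSet
    {x : Sph d × Sph d | x.2 ∈ {z : Sph d | α ≤ inner ℝ (z : Pt d) (x.1 : Pt d) ∧
      β ≤ inner ℝ (z : Pt d) q}} :=
  (measurableSet_pair_cap α).inter (measurable_snd (measurableSet_cap β q))

/-- For frozen q and p_j the wedge has measure at least n^(-θ)/2 with θ < 1. So it contains no data
point with probability at most exp(-n^(1 - θ)/8), which beats the union over j. -/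
theorem IsSparse.tendsto_stuck (h : IsSparse n) {γ κ b : ℝ} (hγ : γ ^ 2 ≤ 1) (hκ : 0 ≤ κ)
    (hb : 0 ≤ b) (hκb : κ ^ 2 + b ^ 2 < 1) :
    Tendsto (fun d => sampleLaw d (n d)
      {x | |(inner ℝ (x.1 x.2.1 : Pt d) (x.2.2.1 : Pt d) : ℝ)| < 1 / 2 ∧
        ∃ j ≠ x.2.1,
          |inner ℝ (x.1 j : Pt d) (plantedQuery γ (x.1 x.2.1 : Pt d) (x.2.2.1 : Pt d))| ≤
            2 * muParam d (n d) ∧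
          ∀ k, k ≠ x.2.1 → k ≠ j → ¬ (κ * muParam d (n d) ≤ inner ℝ (x.1 k : Pt d) (x.1 j : Pt d) ∧
            b * muParam d (n d) + 1 / d ≤
              inner ℝ (x.1 k : Pt d) (plantedQuery γ (x.1 x.2.1 : Pt d) (x.2.2.1 : Pt d)))})
      atTop (𝓝 0) := by
  obtain ⟨ε, hε, hε1⟩ : ∃ ε > 0, κ ^ 2 + b ^ 2 + 50 * ε < 1 :=
    ⟨(1 - (κ ^ 2 + b ^ 2)) / 100, by linarith, by linarith⟩
  have hκ1 : κ ≤ 1 := by nlinarith [sq_nonneg b]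
  have hb1 : b ≤ 1 := by nlinarith [sq_nonneg κ]
  set θ := κ ^ 2 + b ^ 2 + 50 * ε with hθ
  -- The constant 1/8 collects three halves: the wedge bound, at least n/2 remaining points, and the
  -- lower tail inequality.
  refine tendsto_zero_of_le_ofReal ?_ (h.tendsto_mul_exp_neg (s := 1 - θ) (C := 1 / 8)
    (by linarith) (by norm_num))
  filter_upwards [h.eventually_pos, eventually_gt_atTop 0,
    h.eventually_le_wedge hκ hκ1 hb hb1 hε (by nlinarith [sq_nonneg κ, sq_nonneg b]) hε1.le,
    h.tendsto.eventually_ge_atTop 4] with d hn hd hwedge hn4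
  refine sampleLaw_le_of_update hd hn (fun i s => ?_) fun i p v s => ?_
  · have hq := measurable_query (d := d) γ i
    refine (measurableSet_dir i).inter (MeasurableSet.congr (MeasurableSet.iUnion fun j =>
      MeasurableSet.iUnion fun (_ : j ≠ i) => MeasurableSet.inter
        (s₁ := {x : (Fin (n d) → Sph d) × Sph d | |inner ℝ (x.1 j : Pt d)
          (plantedQuery γ (x.1 i : Pt d) (x.2 : Pt d))| ≤ 2 * muParam d (n d)})
        (s₂ := ⋂ k, ⋂ (_ : k ≠ i), ⋂ (_ : k ≠ j), {x : (Fin (n d) → Sph d) × Sph d |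
          κ * muParam d (n d) ≤ inner ℝ (x.1 k : Pt d) (x.1 j : Pt d) ∧
          b * muParam d (n d) + 1 / d ≤ inner ℝ (x.1 k : Pt d)
            (plantedQuery γ (x.1 i : Pt d) (x.2 : Pt d))}ᶜ) ?_ ?_) ?_)
    · exact measurableSet_le (by fun_prop) measurable_const
    · refine MeasurableSet.iInter fun k => MeasurableSet.iInter fun _ =>
        MeasurableSet.iInter fun _ => MeasurableSet.compl ?_
      have hm : Measurable fun x : (Fin (n d) → Sph d) × Sph d => (x.1 j, x.1 k) := by fun_prop
      refine (hm (measurableSet_pair_cap _)).inter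
        (measurableSet_le (f := fun _ => b * muParam d (n d) + 1 / d)
          (g := fun x : (Fin (n d) → Sph d) × Sph d => inner ℝ (x.1 k : Pt d)
            (plantedQuery γ (x.1 i : Pt d) (x.2 : Pt d))) measurable_const (by fun_prop))
    · ext x
      simp only [Set.mem_iUnion, Set.mem_inter_iff, Set.mem_iInter, Set.mem_compl_iff,
        Set.mem_ofPred_eq, exists_prop]
      rfl
  · by_cases hv : |(inner ℝ (p : Pt d) (v : Pt d) : ℝ)| < 1 / 2
    swap
    · refine (measure_mono_null (t := ∅) (fun D hD => hv ?_) measure_empty).le.trans zero_le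
      have h1 : |(inner ℝ (Function.update D i p i : Pt d) (v : Pt d) : ℝ)| < 1 / 2 := hD.1
      rwa [Function.update_self] at h1
    have := isProbabilityMeasure_uniformSphere hd
    have hq := norm_query hγ hv
    set q := plantedQuery γ (p : Pt d) (v : Pt d) with hqdef
    have hn' : (0 : ℝ) < n d := by exact_mod_cast hn
    classical
    refine (measure_le_of_subset_iUnion (t := Real.exp (-(1 / 8 * (n d : ℝ) ^ (1 - θ))))
      (U := fun j => {D : Fin (n d) → Sph d |
        D j ∈ {x : Sph d | |inner ℝ (x : Pt d) q| ≤ 2 * muParam d (n d)} ∧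
        (((Finset.univ.erase i).erase j).filter fun k => D k ∈
          {z : Sph d | κ * muParam d (n d) ≤ inner ℝ (z : Pt d) (D j : Pt d) ∧
            b * muParam d (n d) + 1 / d ≤ inner ℝ (z : Pt d) q}).card ≤ 0}) ?_ fun j => ?_)
    · rintro D ⟨-, j, hj, hD1, hD2⟩
      simp only [Function.update_of_ne hj, Function.update_self] at hD1 hD2
      refine Set.mem_iUnion.2 ⟨j, hD1, ?_⟩
      rw [nonpos_iff_eq_zero, Finset.card_eq_zero, Finset.filter_eq_empty_iff]
      intro k hk hk2
      simp only [Finset.mem_erase] at hk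
      have := hD2 k hk.2.1 hk.1
      rw [Function.update_of_ne hk.2.1] at this
      exact this hk2
    · have hb := pi_card_filter_le (ν := uniformSphere d)
        (measurableSet_wedge (κ * muParam d (n d)) (b * muParam d (n d) + 1 / d) q) (j := j)
        (T := (Finset.univ.erase i).erase j) (Finset.notMem_erase _ _)
        (G := {x : Sph d | |inner ℝ (x : Pt d) q| ≤ 2 * muParam d (n d)})
        (measurableSet_le (by fun_prop) measurable_const)
        (p := (n d : ℝ) ^ (-θ) / 2) (fun x hx => hwedge x q (by simp) hq hx) 0
      refine le_trans (le_of_eq ?_) (hb.trans (ENNReal.ofReal_le_ofReal ?_))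
      · congr!
      · rw [pow_zero, one_mul]
        refine Real.exp_le_exp.2 (neg_le_neg ?_)
        have hcard : (n d : ℝ) / 2 ≤ ((Finset.univ.erase i).erase j).card := by
          have h1 : n d ≤ ((Finset.univ.erase i).erase j).card + 2 := by
            have h2 := Finset.pred_card_le_card_erase (s := Finset.univ.erase i) (a := j)
            rw [Finset.card_erase_of_mem (Finset.mem_univ i), Finset.card_univ,
              Fintype.card_fin] at h2
            omega
          have h3 : (n d : ℝ) ≤ ((Finset.univ.erase i).erase j).card + 2 := by exact_mod_cast h1
          linarith
        have e1 : (n d : ℝ) ^ (1 - θ) = (n d : ℝ) ^ (-θ) * n d := by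
          rw [sub_eq_neg_add, Real.rpow_add_one hn'.ne']
        have e2 : 0 ≤ (n d : ℝ) ^ (-θ) := by positivity
        rw [e1]
        nlinarith

/-! ### Bucket sizes. -/

open Classical in
theorem card_buckets {d k : ℕ} (α : ℝ) (D : Fin k → Sph d) (j : Fin k) :
    (buckets α (fun l => (D l : Pt d)) Finset.univ j).card =
      ((Finset.univ.erase j).filter fun l =>
        D l ∈ {y : Sph d | α ≤ inner ℝ (y : Pt d) (D j : Pt d)}).card := by
  congr 1
  ext l
  rw [mem_buckets_univ, Finset.mem_filter, Finset.mem_erase]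
  simp only [Finset.mem_univ, and_true, Set.mem_ofPred_eq]
  rw [real_inner_comm, ne_comm]

theorem measurableSet_card_buckets {d k : ℕ} (α : ℝ) (j : Fin k) (S : Set ℕ) : MeasurableSet
    {D : Fin k → Sph d | (buckets α (fun l => (D l : Pt d)) Finset.univ j).card ∈ S} := by
  classical
  simp only [card_buckets]
  refine measurable_card_filter (X := Fin k → Sph d) (Finset.univ.erase j) (p := fun l D =>
    D l ∈ {y : Sph d | α ≤ inner ℝ (y : Pt d) (D j : Pt d)}) (fun l => ?_) (.of_discrete (s := S))
  change MeasurableSet {D : Fin k → Sph d | α ≤ inner ℝ (D l : Pt d) (D j : Pt d)}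
  exact measurableSet_le measurable_const (by fun_prop)

theorem IsSparse.tendsto_large_bucket (h : IsSparse n) {κ ε : ℝ} (hκ : 0 ≤ κ) (hκ1 : κ < 1)
    (hε : 0 < ε) :
    Tendsto (fun d => sampleLaw d (n d) {x | ∃ j, (n d : ℝ) ^ (1 - κ ^ 2 + ε) <
        (buckets (κ * muParam d (n d)) (fun l => (x.1 l : Pt d)) Finset.univ j).card})
      atTop (𝓝 0) := by
  have hs : 0 < 1 - κ ^ 2 := by nlinarith
  refine tendsto_zero_of_le_ofReal ?_ (h.tendsto_mul_exp_neg (s := 1 - κ ^ 2 + ε) (C := 1 / 4)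
    (by positivity) (by norm_num))
  have hε' : 0 < ε / 2 := by positivity
  filter_upwards [h.eventually_pos, eventually_gt_atTop 0, h.eventually_exp_le (s := κ) hε',
    h.eventually_muParam_le (show (0 : ℝ) < 1 / 2 by norm_num),
    h.eventually_const_mul_rpow_le 4 (show 1 - κ ^ 2 + ε / 2 < 1 - κ ^ 2 + ε by linarith)]
    with d hn hd hexp hμ hK
  have := isProbabilityMeasure_uniformSphere hd
  have hμ0 := muParam_nonneg d (n d)
  have hn' : (0 : ℝ) < n d := by exact_mod_cast hn
  have hn1 : (1 : ℝ) ≤ n d := by exact_mod_cast hn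
  set α := κ * muParam d (n d) with hα
  set M := (n d : ℝ) ^ (1 - κ ^ 2 + ε) with hM
  have hα2 : α ^ 2 ≤ 1 / 2 := by
    have : α ≤ 1 * (1 / 2) := by rw [hα]; gcongr
    have : 0 ≤ α := by positivity
    nlinarith
  classical
  have hW := measurableSet_pair_cap (d := d) α
  have hp : ∀ x : Sph d, (uniformSphere d).real {y : Sph d | α ≤ inner ℝ (y : Pt d) (x : Pt d)} ≤
      (n d : ℝ) ^ (-(κ ^ 2 * (1 - ε / 2))) := fun x =>
    (uniformSphere_cap_le hd (by positivity) hα2 (by simp)).trans hexp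
  refine sampleLaw_le hd hn (fun i s => ?_) fun i v s => ?_
  · refine MeasurableSet.congr (MeasurableSet.iUnion fun j =>
      (measurableSet_card_buckets α j {m | M < m}).preimage measurable_fst) ?_
    ext x; simp
  · refine measure_le_of_subset_iUnion (U := fun j => {D : Fin (n d) → Sph d | ⌈M⌉₊ ≤
      ((Finset.univ.erase j).filter fun l =>
        D l ∈ {y : Sph d | α ≤ inner ℝ (y : Pt d) (D j : Pt d)}).card}) ?_ fun j => ?_
    · rintro D ⟨j, hj⟩
      refine Set.mem_iUnion.2 ⟨j, ?_⟩
      rw [card_buckets] at hj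
      exact Nat.ceil_le.2 hj.le
    · refine (pi_le_card_filter hW (Finset.notMem_erase j _) hp _).trans
        (ENNReal.ofReal_le_ofReal ?_)
      have hlog : (1 / 2 : ℝ) ≤ Real.log 2 := by linarith [Real.log_two_gt_d9]
      have e1 : (2 : ℝ) ^ ⌈M⌉₊ = Real.exp (⌈M⌉₊ * Real.log 2) := by
        rw [Real.exp_nat_mul, Real.exp_log two_pos]
      rw [e1, ← Real.exp_sub]
      refine Real.exp_le_exp.2 ?_
      have h1 : M ≤ ⌈M⌉₊ := Nat.le_ceil M
      have hcard : ((Finset.univ.erase j).card : ℝ) ≤ n d := by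
        have := Finset.card_le_univ (Finset.univ.erase j)
        rw [Fintype.card_fin] at this
        exact_mod_cast this
      have h2 : (n d : ℝ) ^ (-(κ ^ 2 * (1 - ε / 2))) * (Finset.univ.erase j).card ≤ M / 4 := by
        calc _ ≤ (n d : ℝ) ^ (-(κ ^ 2 * (1 - ε / 2))) * n d := by gcongr
          _ = (n d : ℝ) ^ (-(κ ^ 2 * (1 - ε / 2)) + 1) := by rw [Real.rpow_add_one hn'.ne']
          _ ≤ (n d : ℝ) ^ (1 - κ ^ 2 + ε / 2) := by
            refine Real.rpow_le_rpow_of_exponent_le hn1 ?_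
            nlinarith
          _ ≤ M / 4 := by linarith
      have h3 : M * (1 / 2) ≤ ⌈M⌉₊ * Real.log 2 := by gcongr
      linarith

/-- An auxiliary direction: with b = 0, the wedge estimate bounds a single cap from below. -/
theorem exists_unit_orthogonal {d : ℕ} (hd : 2 ≤ d) (x : Pt d) :
    ∃ q : Pt d, ‖q‖ = 1 ∧ inner ℝ x q = (0 : ℝ) := by
  have h1 : 0 < Module.finrank ℝ (ℝ ∙ x)ᗮ := by
    have h2 := Submodule.finrank_add_finrank_orthogonal (ℝ ∙ x)
    rw [finrank_euclideanSpace, Fintype.card_fin] at h2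
    have h3 := finrank_span_le_card (R := ℝ) ({x} : Set (Pt d))
    rw [Set.toFinset_singleton, Finset.card_singleton] at h3
    omega
  have : Nontrivial (ℝ ∙ x)ᗮ := Module.finrank_pos_iff.1 h1
  obtain ⟨q, hq⟩ := exists_norm_eq (ℝ ∙ x)ᗮ zero_le_one
  exact ⟨q, hq, Submodule.mem_orthogonal_singleton_iff_inner_right.1 q.2⟩

theorem IsSparse.tendsto_small_bucket (h : IsSparse n) {κ ε : ℝ} (hκ : 0 ≤ κ) (hκ1 : κ < 1)
    (hε : 0 < ε) :
    Tendsto (fun d => sampleLaw d (n d) {x | ∃ j,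
        ((buckets (κ * muParam d (n d)) (fun l => (x.1 l : Pt d)) Finset.univ j).card : ℝ) <
          (n d : ℝ) ^ (1 - κ ^ 2 - ε)})
      atTop (𝓝 0) := by
  have hs : 0 < 1 - κ ^ 2 := by nlinarith
  obtain ⟨ε₀, hε₀, hε₁, hε₂⟩ : ∃ ε₀ > 0, 50 * ε₀ < ε ∧ 50 * ε₀ < 1 - κ ^ 2 := by
    refine ⟨min ε (1 - κ ^ 2) / 100, by positivity, ?_, ?_⟩
    · linarith [min_le_left ε (1 - κ ^ 2), lt_min hε hs]
    · linarith [min_le_right ε (1 - κ ^ 2), lt_min hε hs]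
  set m := 1 - κ ^ 2 - 50 * ε₀ with hm
  refine tendsto_zero_of_le_ofReal ?_ (h.tendsto_mul_exp_neg (s := m) (C := 1 / 16)
    (by linarith) (by norm_num))
  filter_upwards [h.eventually_pos, eventually_ge_atTop 2,
    h.eventually_le_wedge hκ hκ1.le le_rfl zero_le_one hε₀ (by nlinarith) (by nlinarith),
    h.eventually_const_mul_rpow_le 16 (show 1 - κ ^ 2 - ε < m by linarith),
    h.tendsto.eventually_ge_atTop 2] with d hn hd2 hwedge hK hn2
  have hd : 0 < d := by omega
  have := isProbabilityMeasure_uniformSphere hd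
  have hμ0 := muParam_nonneg d (n d)
  have hn' : (0 : ℝ) < n d := by exact_mod_cast hn
  set α := κ * muParam d (n d) with hα
  set M := (n d : ℝ) ^ (1 - κ ^ 2 - ε) with hM
  have hM0 : 0 ≤ M := by positivity
  classical
  have hW := measurableSet_pair_cap (d := d) α
  have hp : ∀ x ∈ (Set.univ : Set (Sph d)), (n d : ℝ) ^ (-(κ ^ 2 + 50 * ε₀)) / 2 ≤
      (uniformSphere d).real {y : Sph d | α ≤ inner ℝ (y : Pt d) (x : Pt d)} := by
    intro x _
    obtain ⟨q, hq, hxq⟩ := exists_unit_orthogonal hd2 (x : Pt d)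
    have h1 := hwedge x q (by simp) hq (by rw [hxq, abs_zero]; positivity)
    have e1 : κ ^ 2 + 0 ^ 2 + 50 * ε₀ = κ ^ 2 + 50 * ε₀ := by ring
    rw [e1] at h1
    exact h1.trans (measureReal_mono fun z hz => hz.1)
  refine sampleLaw_le hd hn (fun i s => ?_) fun i v s => ?_
  · refine MeasurableSet.congr (MeasurableSet.iUnion fun j =>
      (measurableSet_card_buckets α j {m | (m : ℝ) < M}).preimage measurable_fst) ?_
    ext x; simp
  · refine measure_le_of_subset_iUnion (U := fun j => {D : Fin (n d) → Sph d |
      D j ∈ (Set.univ : Set (Sph d)) ∧ ((Finset.univ.erase j).filter fun l =>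
        D l ∈ {y : Sph d | α ≤ inner ℝ (y : Pt d) (D j : Pt d)}).card ≤ ⌊M⌋₊}) ?_ fun j => ?_
    · rintro D ⟨j, hj⟩
      refine Set.mem_iUnion.2 ⟨j, Set.mem_univ _, ?_⟩
      rw [card_buckets] at hj
      exact Nat.le_floor hj.le
    · refine (pi_card_filter_le hW (Finset.notMem_erase j _) .univ hp _).trans
        (ENNReal.ofReal_le_ofReal ?_)
      have hlog : Real.log 2 ≤ 1 := by linarith [Real.log_two_lt_d9]
      have e1 : (2 : ℝ) ^ ⌊M⌋₊ = Real.exp (⌊M⌋₊ * Real.log 2) := by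
        rw [Real.exp_nat_mul, Real.exp_log two_pos]
      rw [e1, ← Real.exp_add]
      refine Real.exp_le_exp.2 ?_
      have h1 : (⌊M⌋₊ : ℝ) ≤ M := Nat.floor_le hM0
      have hcard : (n d : ℝ) / 2 ≤ (Finset.univ.erase j).card := by
        rw [Finset.card_erase_of_mem (Finset.mem_univ j), Finset.card_univ, Fintype.card_fin,
          Nat.cast_sub hn]
        push_cast
        linarith
      have h2 : (n d : ℝ) ^ m = (n d : ℝ) ^ (-(κ ^ 2 + 50 * ε₀)) * n d := by
        rw [← Real.rpow_add_one hn'.ne']; congr 1; rw [hm]; ring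
      have h3 : ⌊M⌋₊ * Real.log 2 ≤ M * 1 := by gcongr
      have h4 : (n d : ℝ) ^ m / 8 ≤
          (n d : ℝ) ^ (-(κ ^ 2 + 50 * ε₀)) / 2 * (Finset.univ.erase j).card / 2 := by
        have h5 : (n d : ℝ) ^ (-(κ ^ 2 + 50 * ε₀)) / 2 * ((n d : ℝ) / 2) ≤
          (n d : ℝ) ^ (-(κ ^ 2 + 50 * ε₀)) / 2 * (Finset.univ.erase j).card := by gcongr
        rw [h2]
        linarith
      linarith

end Events

/-! ### One instance -/

section Instance

/-- The deterministic core: outside the exceptional events, the walk that ignores the planted point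
ends next to it. -/
theorem exists_tour_planted {d m : ℕ} (hd : 0 < d) {α γ μ b δ : ℝ} (ω : Sample d m)
    (hs : ω.start ≠ ω.planted) (hq : ‖ω.query γ‖ = 1)
    (hheight : ∀ j ≠ ω.planted, |(inner ℝ (ω.pts j) (ω.query γ) : ℝ)| < 2 * μ)
    (hμ : 2 * μ + 1 / d ≤ γ)
    (hstuck : ∀ j ≠ ω.planted, |(inner ℝ (ω.pts j) (ω.query γ) : ℝ)| ≤ 2 * μ →
      ∃ k, k ≠ ω.planted ∧ k ≠ j ∧ α ≤ inner ℝ (ω.pts k) (ω.pts j) ∧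
        b * μ + 1 / d ≤ inner ℝ (ω.pts k) (ω.query γ))
    (hfar : ω.data ∉ farEnd α γ (δ * μ) (ω.pts ω.planted) (ω.query γ) ω.planted ω.start)
    (hγ : 0 ≤ γ) (hα : α ≤ (γ * b - δ) * μ) {M : ℕ}
    (hM : ∀ j, (buckets α ω.pts Finset.univ j).card ≤ M) :
    ∃ t, Tour ω.pts (buckets α ω.pts Finset.univ) (ω.query γ) γ ω.start (some ω.planted) t ∧
      (buckets α ω.pts Finset.univ ω.start).card ≤ t ∧
      t ≤ (2 * d + 1 + 2) * ((d + 1) * (M + 1)) := by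
  have hd' : (0 : ℝ) < 1 / d := by positivity
  have hunit : ∀ j, ‖ω.pts j‖ = 1 := fun j => by simp [Sample.pts]
  have hγi : inner ℝ (ω.pts ω.planted) (ω.query γ) = γ :=
    inner_plantedQuery_left (hunit _) _ _
  have hlt : ∀ j ≠ ω.planted, inner ℝ (ω.pts j) (ω.query γ) + 1 / (d : ℝ) ≤ γ := fun j hj => by
    have := (abs_lt.1 (hheight j hj)).2
    linarith
  set e := walkEnd α ω.pts (ω.query γ) ω.planted ω.start with he
  have hei : e ≠ ω.planted := walkEnd_ne hs
  -- An end below height bμ would have a neighbor above bμ + 1/d, contrary to local optimality.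
  have hbe : b * μ ≤ inner ℝ (ω.pts e) (ω.query γ) := by
    by_contra! hcon
    obtain ⟨k, hki, hke, hk1, hk2⟩ := hstuck e hei (hheight e hei).le
    refine passes_stuck (P := ω.pts) (q := ω.query γ)
      (B := fun j => (buckets α ω.pts Finset.univ j).erase ω.planted) hd (fun j => ?_) ω.start k
      (Finset.mem_erase.2 ⟨hki, mem_buckets_univ.2 ⟨hke.symm, ?_⟩⟩) ?_
    · have := abs_real_inner_le_norm (ω.pts j) (ω.query γ)
      rwa [hunit, hq, one_mul] at this
    · rw [real_inner_comm]; exact hk1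
    · change inner ℝ (ω.pts e) (ω.query γ) + 1 / (d : ℝ) ≤ _
      linarith
  have hmem : ω.planted ∈ buckets α ω.pts Finset.univ e := by
    refine mem_buckets_univ.2 ⟨hei, ?_⟩
    have h1 : γ * inner ℝ (ω.pts e) (ω.query γ) - δ * μ ≤
        inner ℝ (ω.pts e) (ω.pts ω.planted) := not_lt.1 hfar
    have h2 := mul_le_mul_of_nonneg_left hbe hγ
    linarith
  obtain ⟨t, ht, htM⟩ := exists_tour hd hγi hlt hM (2 * d + 1) hs hmem
  exact ⟨t, ht, card_le_of_tour ht (by have := hlt _ hs; linarith), htM⟩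

/-- One iteration of the query algorithm returns the planted point, and the costs are, up to a
factor `n ^ ε`, `n ^ ρ` for queries and deletions, `n ^ (1 + ρ)` for space, and `n` for
insertions. -/
def GoodSample {d m : ℕ} (α γ ρ ε : ℝ) (ω : Sample d m) : Prop :=
  (∃ t : ℕ, Tour ω.pts (buckets α ω.pts Finset.univ) (ω.query γ) γ ω.start (some ω.planted) t ∧
    PowerWithin m ρ ε t) ∧
  PowerWithin m (1 + ρ) ε (spaceCost α ω.pts) ∧
  (∀ x : Sph d, PowerWithin m 1 ε (insertCost α ω.pts x)) ∧
  (∀ i : Fin m, PowerWithin m ρ ε (deleteCost α ω.pts i))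

theorem PowerWithin.mono {m t : ℕ} {ρ ρ' ε ε' : ℝ} (hm : 0 < m) (h : |ρ - ρ'| + ε ≤ ε')
    (ht : PowerWithin m ρ ε t) : PowerWithin m ρ' ε' t := by
  have hm1 : (1 : ℝ) ≤ m := by exact_mod_cast hm
  have h1 := le_abs_self (ρ - ρ')
  have h2 := neg_abs_le (ρ - ρ')
  exact ⟨(Real.rpow_le_rpow_of_exponent_le hm1 (by linarith)).trans ht.1,
    ht.2.trans (Real.rpow_le_rpow_of_exponent_le hm1 (by linarith))⟩

theorem GoodSample.mono {d m : ℕ} {α γ ρ ρ' ε ε' : ℝ} {ω : Sample d m} (hm : 0 < m)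
    (h : |ρ - ρ'| + ε ≤ ε') (hω : GoodSample α γ ρ ε ω) : GoodSample α γ ρ' ε' ω := by
  obtain ⟨⟨t, ht, ht'⟩, h2, h3, h4⟩ := hω
  refine ⟨⟨t, ht, ht'.mono hm h⟩, h2.mono hm (by rwa [add_sub_add_left_eq_sub]),
    fun x => (h3 x).mono hm ?_, fun i => (h4 i).mono hm h⟩
  rw [sub_self, abs_zero]
  linarith [abs_nonneg (ρ - ρ')]

theorem spaceCost_bounds {d m : ℕ} {α : ℝ} {P : Fin m → Pt d} {K M : ℝ} (hm : 2 ≤ m)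
    (hK : ∀ j, K ≤ (buckets α P Finset.univ j).card)
    (hM : ∀ j, ((buckets α P Finset.univ j).card : ℝ) ≤ M) :
    m * K ≤ spaceCost α P ∧ (spaceCost α P : ℝ) ≤ m * (d + M * (Nat.log 2 (m + 1) + 1)) := by
  have h1 : 1 ≤ Nat.clog 2 m := Nat.clog_pos one_lt_two hm
  have h2 : Nat.clog 2 m ≤ Nat.log 2 (m + 1) + 1 := by
    rw [Nat.clog_of_two_le one_lt_two hm]
    have h3 : (m + 2 - 1) / 2 ≤ 2 ^ Nat.log 2 (m + 1) := by
      have := Nat.lt_pow_succ_log_self one_lt_two (m + 1)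
      rw [pow_succ] at this
      omega
    exact Nat.add_le_add_right (Nat.clog_le_of_le_pow h3) 1
  have h1' : (1 : ℝ) ≤ Nat.clog 2 m := by exact_mod_cast h1
  have h2' : (Nat.clog 2 m : ℝ) ≤ Nat.log 2 (m + 1) + 1 := by exact_mod_cast h2
  rw [spaceCost]
  push_cast
  constructor
  · have h4 : ∑ _j : Fin m, K ≤ ∑ j, ((buckets α P Finset.univ j).card : ℝ) * Nat.clog 2 m :=
      Finset.sum_le_sum fun j _ => by nlinarith [hK j]
    rw [Finset.sum_const, Finset.card_univ, Fintype.card_fin, nsmul_eq_mul] at h4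
    have : (0 : ℝ) ≤ m * d := by positivity
    linarith
  · have h4 : ∑ j, ((buckets α P Finset.univ j).card : ℝ) * Nat.clog 2 m ≤
        ∑ _j : Fin m, M * (Nat.log 2 (m + 1) + 1) := Finset.sum_le_sum fun j _ => by
      have := hM j
      gcongr
      exact le_trans (Nat.cast_nonneg _) this
    rw [Finset.sum_const, Finset.card_univ, Fintype.card_fin, nsmul_eq_mul] at h4
    rw [mul_add]
    linarith

variable {n : ℕ → ℕ}

theorem IsSparse.eventually_natLog_le (h : IsSparse n) {ε : ℝ} (hε : 0 < ε) :
    ∀ᶠ d in atTop, (Nat.log 2 (n d + 1) + 1 : ℝ) ≤ (n d : ℝ) ^ ε := by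
  have h1 := (isLittleO_log_rpow_atTop hε).comp_tendsto h.tendsto
  filter_upwards [h1.bound (show (0 : ℝ) < 1 / 4 by norm_num), h.eventually_pos,
    h.tendsto_log.eventually_ge_atTop 1] with d h2 hn hL
  have hn' : (0 : ℝ) < n d := by exact_mod_cast hn
  simp only [Function.comp_apply] at h2
  rw [Real.norm_of_nonneg (by linarith), Real.norm_of_nonneg (by positivity)] at h2
  have h3 : Nat.log 2 (n d + 1) ≤ Nat.log 2 (n d) + 1 := by
    rw [← Nat.log_mul_base one_lt_two hn.ne']
    exact Nat.log_mono_right (by omega)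
  have h4 : (Nat.log 2 (n d) : ℝ) ≤ 2 * Real.log (n d) := by
    have h5 := Real.natLog_le_logb (n d) 2
    rw [Nat.cast_ofNat] at h5
    have h6 : Real.logb 2 (n d) ≤ 2 * Real.log (n d) := by
      rw [Real.logb, div_le_iff₀ (Real.log_pos (by norm_num))]
      have : (1 / 2 : ℝ) ≤ Real.log 2 := by linarith [Real.log_two_gt_d9]
      have h7 := mul_le_mul_of_nonneg_left this (show 0 ≤ Real.log (n d) by linarith)
      linarith
    exact h5.trans h6
  have h3' : (Nat.log 2 (n d + 1) : ℝ) ≤ Nat.log 2 (n d) + 1 := by exact_mod_cast h3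
  linarith

/-- With fixed parameters below the threshold, instances are good with high probability. -/
theorem IsSparse.withHighProbability_goodSample (h : IsSparse n) {γ κ ε : ℝ} (hγ : 0 < γ)
    (hγ1 : γ < 1) (hκ : 0 < κ) (hκγ : κ ^ 2 * (1 + γ ^ 2) < γ ^ 2) (hε : 0 < ε) :
    WithHighProbability n fun d ω => GoodSample (κ * muParam d (n d)) γ (1 - κ ^ 2) ε ω := by
  have hγ2 : γ ^ 2 ≤ 1 := by nlinarith
  have hκ2 : κ ^ 2 < 1 := by nlinarith [mul_pos (pow_pos hκ 2) (pow_pos hγ 2)]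
  have hκ1 : κ < 1 := by nlinarith
  -- b < √(1 - κ²) keeps the walk from getting stuck below bμ; b > κ/γ makes its end a neighbor of
  -- the planted point. The hypothesis `hκγ` says that this interval is nonempty.
  obtain ⟨b, hb1, hb2⟩ : ∃ b, κ / γ < b ∧ b < √(1 - κ ^ 2) := by
    refine exists_between (Real.lt_sqrt_of_sq_lt ?_)
    rw [div_pow, div_lt_iff₀ (by positivity)]
    linarith
  have hb0 : 0 < b := lt_trans (by positivity) hb1
  have hκb : κ ^ 2 + b ^ 2 < 1 := by
    have := (Real.lt_sqrt hb0.le).1 hb2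
    linarith
  obtain ⟨δ, hδ, hδb⟩ : ∃ δ > 0, κ ≤ γ * b - δ := by
    refine ⟨γ * b - κ, ?_, by linarith⟩
    rw [div_lt_iff₀ hγ] at hb1
    linarith
  -- At most three factors n^ε₁ arise, from d, logarithms and the bucket bound; the fourth absorbs
  -- numerical constants.
  set ε₁ := ε / 4 with hε₁
  have hε₁0 : 0 < ε₁ := by positivity
  have hε4 : ε = 4 * ε₁ := by rw [hε₁]; ring
  set ρ := 1 - κ ^ 2 with hρ
  have hρ0 : 0 < ρ := by linarith
  have hlim := (((((h.tendsto_planted_eq_start.add h.tendsto_dir).add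
    (h.tendsto_height hγ2)).add
    (h.tendsto_farEnd hγ2 hδ fun d => κ * muParam d (n d))).add
    (h.tendsto_stuck hγ2 hκ.le hb0.le hκb)).add
    (h.tendsto_large_bucket hκ.le hκ1 hε₁0)).add
    (h.tendsto_small_bucket hκ.le hκ1 hε₁0)
  simp only [add_zero] at hlim
  refine tendsto_of_tendsto_of_tendsto_of_le_of_le' tendsto_const_nhds hlim
    (Eventually.of_forall fun _ => zero_le) ?_
  filter_upwards [eventually_gt_atTop 0, h.tendsto.eventually_ge_atTop 2,
    h.eventually_muParam_le (show 0 < γ / 3 by positivity),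
    h.eventually_inv_le (show (0 : ℝ) < 1 by norm_num),
    h.eventually_natCast_le hε₁0, h.eventually_natLog_le hε₁0,
    h.eventually_const_mul_rpow_le 20 (show ρ + 3 * ε₁ < ρ + ε by linarith),
    h.eventually_const_mul_rpow_le 5 (show 1 + ε₁ < 1 + ε by linarith),
    h.eventually_const_mul_rpow_le 2 (show ρ + 2 * ε₁ < ρ + ε by linarith),
    h.eventually_const_mul_rpow_le 2 (show 1 + ρ + 2 * ε₁ < 1 + ρ + ε by linarith)]
    with d hd hn2 hμγ hdμ hdn hlog hT hI hD hS
  refine le_trans (measure_mono ?_) ((measure_union_le _ _).trans (add_le_add_left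
    ((measure_union_le _ _).trans (add_le_add_left ((measure_union_le _ _).trans (add_le_add_left
    ((measure_union_le _ _).trans (add_le_add_left ((measure_union_le _ _).trans (add_le_add_left
    (measure_union_le _ _) _)) _)) _)) _)) _))
  rintro _ ⟨ω, hω, rfl⟩
  by_contra hbad
  refine hω ?_
  simp only [Set.mem_union, not_or] at hbad
  obtain ⟨⟨⟨⟨⟨⟨h0, h1⟩, h2⟩, h3⟩, h4⟩, h5⟩, h6⟩ := hbad
  have hn2' : 2 ≤ n d := by exact_mod_cast hn2
  have hn1 : (1 : ℝ) ≤ n d := by linarith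
  have hn0 : (0 : ℝ) < n d := by linarith
  have hd1 : (1 : ℝ) ≤ d := by exact_mod_cast hd
  set μ := muParam d (n d) with hμ
  set α := κ * μ with hα
  have hμ0 : 0 ≤ μ := muParam_nonneg _ _
  have hs : ω.start ≠ ω.planted := fun h => h0 h.symm
  have hdir : |(inner ℝ (ω.pts ω.planted) (ω.dir : Pt d) : ℝ)| < 1 / 2 := not_le.1 h1
  have hq : ‖ω.query γ‖ = 1 := norm_query hγ2 hdir
  have hheight : ∀ j ≠ ω.planted, |(inner ℝ (ω.pts j) (ω.query γ) : ℝ)| < 2 * μ := fun j hj =>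
    not_le.1 fun hcon => h2 ⟨hdir, j, hj, hcon⟩
  have hfar : ω.data ∉ farEnd α γ (δ * μ) (ω.pts ω.planted) (ω.query γ) ω.planted ω.start :=
    fun hcon => h3 ⟨hdir, hs, hcon⟩
  have hstuck : ∀ j ≠ ω.planted, |(inner ℝ (ω.pts j) (ω.query γ) : ℝ)| ≤ 2 * μ →
      ∃ k, k ≠ ω.planted ∧ k ≠ j ∧ α ≤ inner ℝ (ω.pts k) (ω.pts j) ∧
        b * μ + 1 / d ≤ inner ℝ (ω.pts k) (ω.query γ) := by
    intro j hj hj2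
    by_contra! hcon
    exact h4 ⟨hdir, j, hj, hj2, fun k hk hkj hk2 => absurd hk2.2 (not_le.2 (hcon k hk hkj hk2.1))⟩
  have hup : ∀ j, ((buckets α ω.pts Finset.univ j).card : ℝ) ≤ (n d : ℝ) ^ (ρ + ε₁) := fun j =>
    not_lt.1 fun hcon => h5 ⟨j, hcon⟩
  have hlow : ∀ j, (n d : ℝ) ^ (ρ - ε₁) ≤ (buckets α ω.pts Finset.univ j).card := fun j =>
    not_lt.1 fun hcon => h6 ⟨j, hcon⟩
  set x := (n d : ℝ) ^ ε₁ with hx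
  set M := (n d : ℝ) ^ (ρ + ε₁) with hM
  have hx1 : 1 ≤ x := Real.one_le_rpow hn1 hε₁0.le
  have hM1 : 1 ≤ M := Real.one_le_rpow hn1 (by linarith)
  have hMx : M * x = (n d : ℝ) ^ (ρ + 2 * ε₁) := by
    rw [← Real.rpow_add hn0]; congr 1; ring
  have hMxx : M * x * x = (n d : ℝ) ^ (ρ + 3 * ε₁) := by
    rw [hMx, ← Real.rpow_add hn0]; congr 1; ring
  have hnx : n d * x = (n d : ℝ) ^ (1 + ε₁) := by rw [Real.rpow_one_add' hn0.le (by linarith)]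
  have hnMx : n d * (M * x) = (n d : ℝ) ^ (1 + ρ + 2 * ε₁) := by
    rw [hMx, add_assoc 1, Real.rpow_one_add' hn0.le (by linarith)]
  have hlow' : (n d : ℝ) ^ (ρ - ε) ≤ (n d : ℝ) ^ (ρ - ε₁) :=
    Real.rpow_le_rpow_of_exponent_le hn1 (by linarith)
  refine ⟨?_, ?_, fun y => ?_, fun i => ?_⟩
  · obtain ⟨t, ht, ht1, ht2⟩ := exists_tour_planted hd ω hs hq hheight
      (by linarith) hstuck hfar hγ.le (by rw [hα]; gcongr) (M := ⌊M⌋₊)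
      (fun j => Nat.le_floor (hup j))
    refine ⟨t, ht, (hlow'.trans (hlow _)).trans (by exact_mod_cast ht1), ?_⟩
    have ht2' : (t : ℝ) ≤ (2 * d + 1 + 2) * ((d + 1) * (⌊M⌋₊ + 1)) := by exact_mod_cast ht2
    have hf : (⌊M⌋₊ : ℝ) ≤ M := Nat.floor_le (by linarith)
    calc (t : ℝ) ≤ (2 * d + 1 + 2) * ((d + 1) * (⌊M⌋₊ + 1)) := ht2'
      _ ≤ (5 * x) * ((2 * x) * (2 * M)) := by gcongr <;> linarith
      _ = 20 * (n d : ℝ) ^ (ρ + 3 * ε₁) := by rw [← hMxx]; ring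
      _ ≤ _ := hT
  · obtain ⟨hs1, hs2⟩ := spaceCost_bounds (d := d) hn2' hlow hup
    refine ⟨le_trans ?_ hs1, hs2.trans ?_⟩
    · rw [show 1 + ρ - ε = 1 + (ρ - ε) by ring, Real.rpow_add hn0, Real.rpow_one]
      gcongr
    · calc (n d : ℝ) * (d + M * (Nat.log 2 (n d + 1) + 1)) ≤ n d * (M * x + M * x) := by
            refine mul_le_mul_of_nonneg_left (add_le_add ?_ ?_) hn0.le
            · exact hdn.trans (le_mul_of_one_le_left (by linarith) hM1)
            · exact mul_le_mul_of_nonneg_left hlog (by linarith)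
        _ = 2 * (n d : ℝ) ^ (1 + ρ + 2 * ε₁) := by rw [← hnMx]; ring
        _ ≤ _ := hS
  · obtain ⟨hi1, hi2⟩ := insertCost_bounds α ω.pts (y : Pt d)
    have hi1' : (n d : ℝ) * (d + 1) ≤ insertCost α ω.pts (y : Pt d) := by exact_mod_cast hi1
    have hi2' : (insertCost α ω.pts (y : Pt d) : ℝ) ≤
        n d * (d + 1 + 2 * (Nat.log 2 (n d + 1) + 1)) + 1 := by exact_mod_cast hi2
    constructor
    · calc (n d : ℝ) ^ (1 - ε) ≤ (n d : ℝ) ^ (1 : ℝ) :=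
            Real.rpow_le_rpow_of_exponent_le hn1 (by linarith)
        _ = n d * 1 := by rw [Real.rpow_one, mul_one]
        _ ≤ n d * (d + 1) := by gcongr; linarith
        _ ≤ _ := hi1'
    · calc (insertCost α ω.pts (y : Pt d) : ℝ)
          ≤ n d * (d + 1 + 2 * (Nat.log 2 (n d + 1) + 1)) + 1 := hi2'
        _ ≤ n d * (x + x + 2 * x) + n d * x :=
            add_le_add (mul_le_mul_of_nonneg_left (by linarith) hn0.le)
              (one_le_mul_of_one_le_of_one_le hn1 hx1)
        _ = 5 * (n d : ℝ) ^ (1 + ε₁) := by rw [← hnx]; ring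
        _ ≤ _ := hI
  · obtain ⟨hi1, hi2⟩ := deleteCost_bounds α ω.pts i
    have hi1' : ((buckets α ω.pts Finset.univ i).card : ℝ) ≤ deleteCost α ω.pts i := by
      exact_mod_cast hi1
    have hi2' : (deleteCost α ω.pts i : ℝ) ≤
        (buckets α ω.pts Finset.univ i).card * (Nat.log 2 (n d) + 1) + 1 := by exact_mod_cast hi2
    refine ⟨(hlow'.trans (hlow i)).trans hi1', hi2'.trans ?_⟩
    have hlog2 : (Nat.log 2 (n d) : ℝ) ≤ Nat.log 2 (n d + 1) := by
      exact_mod_cast Nat.log_mono_right (Nat.le_succ _)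
    calc ((buckets α ω.pts Finset.univ i).card : ℝ) * (Nat.log 2 (n d) + 1) + 1
        ≤ M * x + M * x := by
          refine add_le_add (mul_le_mul (hup i) (by linarith) (by positivity) (by linarith)) ?_
          exact one_le_mul_of_one_le_of_one_le hM1 hx1
      _ = 2 * (n d : ℝ) ^ (ρ + 2 * ε₁) := by rw [← hMx]; ring
      _ ≤ _ := hD

end Instance

/-! ### The exponents and the choice of the threshold -/

/-- A sequence that tends to infinity slowly enough to preserve countably many null limits. -/
theorem exists_tendsto_diagonal {f : ℕ → ℕ → ENNReal} (hf : ∀ k, Tendsto (f k) atTop (𝓝 0)) :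
    ∃ k : ℕ → ℕ, Tendsto k atTop atTop ∧ Tendsto (fun d => f (k d) d) atTop (𝓝 0) := by
  classical
  have h1 : ∀ k, ∃ N, ∀ d ≥ N, f k d ≤ ((k : ENNReal) + 1)⁻¹ := fun k => by
    have h2 : (0 : ENNReal) < ((k : ENNReal) + 1)⁻¹ := ENNReal.inv_pos.2 (by simp)
    exact eventually_atTop.1 (((hf k).eventually_lt_const h2).mono fun _ => le_of_lt)
  choose N hN using h1
  let k : ℕ → ℕ := fun d => Nat.findGreatest (fun j => N j ≤ d) d
  have hk : Tendsto k atTop atTop := by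
    refine tendsto_atTop.2 fun J => ?_
    filter_upwards [eventually_ge_atTop J, eventually_ge_atTop (N J)] with d hd1 hd2
    exact Nat.le_findGreatest hd1 hd2
  refine ⟨k, hk, ?_⟩
  have hlim : Tendsto (fun d => ((k d : ENNReal) + 1)⁻¹) atTop (𝓝 0) := by
    have h3 := ENNReal.tendsto_inv_nat_nhds_zero.comp ((tendsto_add_atTop_nat 1).comp hk)
    refine h3.congr fun d => ?_
    simp
  refine tendsto_of_tendsto_of_tendsto_of_le_of_le' tendsto_const_nhds hlim
    (Eventually.of_forall fun _ => zero_le) ?_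
  -- `Nat.findGreatest` defaults to 0, so its defining property is guaranteed only once it holds at
  -- 0.
  filter_upwards [eventually_ge_atTop (N 0)] with d hd
  exact hN _ _ (Nat.findGreatest_spec (P := fun j => N j ≤ d) (Nat.zero_le d) hd)

theorem gammaStar_pos {c : ℝ} (hc : 1 < c) : 0 < gammaStar c := by
  rw [gammaStar, sub_pos, div_lt_one (by positivity)]
  nlinarith

theorem gammaStar_lt_one {c : ℝ} (hc : 1 < c) : gammaStar c < 1 := by
  have : 0 < 1 / c ^ 2 := by positivity
  rw [gammaStar]
  linarith

theorem kappaStar_sq (c : ℝ) : kappaStar c ^ 2 = gammaStar c ^ 2 / (1 + gammaStar c ^ 2) :=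
  Real.sq_sqrt (by positivity)

theorem kappaStar_pos {c : ℝ} (hc : 1 < c) : 0 < kappaStar c := by
  have := gammaStar_pos hc
  exact Real.sqrt_pos.2 (by positivity)

/-- The exponent of the query time. -/
noncomputable def queryExponent (c : ℝ) : ℝ := 1 / (1 + gammaStar c ^ 2)

theorem queryExponent_eq (c : ℝ) : queryExponent c = 1 - kappaStar c ^ 2 := by
  rw [kappaStar_sq, queryExponent]
  have : 1 + gammaStar c ^ 2 ≠ 0 := by positivity
  field_simp
  ring

theorem queryExponent_atTop :
    (fun c => queryExponent c - (1 / 2 + 1 / (2 * c ^ 2))) =O[atTop] fun c : ℝ => 1 / c ^ 4 := by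
  refine IsBigO.of_bound 1 ?_
  filter_upwards [eventually_gt_atTop 1] with c hc
  set u := 1 / c ^ 2 with hu
  have hu0 : 0 < u := by positivity
  have hu1 : u < 1 := by
    have := gammaStar_pos hc
    rw [gammaStar] at this
    linarith
  have e1 : 1 / (2 * c ^ 2) = u / 2 := by rw [hu]; field_simp
  have e2 : 1 / c ^ 4 = u ^ 2 := by rw [hu]; field_simp
  -- With u = 1/c² and γ* = 1 - u, the remainder is an explicit rational function with numerator of
  -- order u².
  have e3 : queryExponent c - (1 / 2 + u / 2) = (u ^ 2 - u ^ 3) / (2 * (1 + (1 - u) ^ 2)) := by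
    rw [queryExponent, gammaStar, ← hu]
    have : 1 + (1 - u) ^ 2 ≠ 0 := by positivity
    field_simp
    ring
  have h0 : 0 ≤ (u ^ 2 - u ^ 3) / (2 * (1 + (1 - u) ^ 2)) := by
    refine div_nonneg ?_ (by positivity)
    nlinarith [mul_nonneg (sq_nonneg u) (sub_nonneg.2 hu1.le)]
  rw [e1, e2, e3, one_mul, Real.norm_of_nonneg h0, Real.norm_of_nonneg (sq_nonneg u),
    div_le_iff₀ (by positivity)]
  nlinarith [mul_nonneg (sq_nonneg u) (sq_nonneg (1 - u)), pow_pos hu0 3, sq_nonneg u]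

theorem queryExponent_nhdsGT :
    (fun c => queryExponent c - (1 - 4 * (c - 1) ^ 2 + 12 * (c - 1) ^ 3)) =O[𝓝[>] 1]
      fun c : ℝ => (c - 1) ^ 4 := by
  -- 209 = 9 + 88 + 88 + 24 is the sum of the coefficients of the cofactor of e⁴ in the exact
  -- remainder, which bounds it for 0 < e < 1.
  refine IsBigO.of_bound 209 ?_
  filter_upwards [Ioo_mem_nhdsGT (show (1 : ℝ) < 2 by norm_num)] with c hc
  obtain ⟨e, rfl⟩ : ∃ e, c = 1 + e := ⟨c - 1, by ring⟩
  have he0 : 0 < e := by linarith [hc.1]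
  have he1 : e < 1 := by linarith [hc.2]
  set S := (1 + e) ^ 4 + e ^ 2 * (2 + e) ^ 2 with hS
  have hS1 : 1 ≤ S := by
    have : 1 ≤ (1 + e) ^ 4 := one_le_pow₀ (by linarith)
    nlinarith [sq_nonneg (e * (2 + e))]
  have hS0 : 0 < S := by linarith
  have hS' : S ≠ 0 := hS0.ne'
  have e1 : queryExponent (1 + e) - (1 - 4 * e ^ 2 + 12 * e ^ 3) =
      -(e ^ 4 * (9 + 88 * e + 88 * e ^ 2 + 24 * e ^ 3)) / S := by
    have h1 : queryExponent (1 + e) = (1 + e) ^ 4 / S := by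
      rw [queryExponent, gammaStar, hS]
      have : 1 + e ≠ 0 := by positivity
      field_simp
      ring
    rw [h1, eq_div_iff hS', sub_mul, div_mul_cancel₀ _ hS', hS]
    ring
  rw [add_sub_cancel_left, e1, norm_div, norm_neg, Real.norm_of_nonneg (by positivity),
    Real.norm_of_nonneg hS0.le, Real.norm_of_nonneg (by positivity), div_le_iff₀ hS0]
  have h2 : 9 + 88 * e + 88 * e ^ 2 + 24 * e ^ 3 ≤ 209 := by
    have : e ^ 2 ≤ 1 := pow_le_one₀ he0.le he1.le
    have : e ^ 3 ≤ 1 := pow_le_one₀ he0.le he1.le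
    linarith
  calc e ^ 4 * (9 + 88 * e + 88 * e ^ 2 + 24 * e ^ 3) ≤ e ^ 4 * 209 := by gcongr
    _ = 209 * e ^ 4 * 1 := by ring
    _ ≤ _ := by gcongr

theorem mainTheorem6 :
    ∃ ρT ρS ρD : ℝ → ℝ,
      -- the exponents as `c → ∞`
      ((fun c => ρT c - (1 / 2 + 1 / (2 * c ^ 2))) =O[atTop] fun c : ℝ => 1 / c ^ 4) ∧
      ((fun c => ρS c - (3 / 2 + 1 / (2 * c ^ 2))) =O[atTop] fun c : ℝ => 1 / c ^ 4) ∧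
      ((fun c => ρD c - (1 / 2 + 1 / (2 * c ^ 2))) =O[atTop] fun c : ℝ => 1 / c ^ 4) ∧
      -- the exponents as `c → 1⁺`
      ((fun c => ρT c - (1 - 4 * (c - 1) ^ 2 + 12 * (c - 1) ^ 3)) =O[𝓝[>] 1]
        fun c : ℝ => (c - 1) ^ 4) ∧
      ((fun c => ρS c - (2 - 4 * (c - 1) ^ 2 + 12 * (c - 1) ^ 3)) =O[𝓝[>] 1]
        fun c : ℝ => (c - 1) ^ 4) ∧
      ((fun c => ρD c - (1 - 4 * (c - 1) ^ 2 + 12 * (c - 1) ^ 3)) =O[𝓝[>] 1]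
        fun c : ℝ => (c - 1) ^ 4) ∧
      -- the costs of the data structure have these exponents
      ∀ c : ℝ, 1 < c → ∀ n : ℕ → ℕ, IsSparse n →
        ∃ κ : ℕ → ℝ, (∀ d, 0 < κ d ∧ κ d < kappaStar c) ∧
          Tendsto κ atTop (𝓝 (kappaStar c)) ∧
          ∀ ε : ℝ, 0 < ε → WithHighProbability n fun d ω =>
            let α : ℝ := κ d * muParam d (n d)
            -- one iteration of the query algorithm returns the planted nearest neighbor
            (∃ t : ℕ, Tour ω.pts (buckets α ω.pts Finset.univ) (ω.query (gammaStar c))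
                (gammaStar c) ω.start (some ω.planted) t ∧ PowerWithin (n d) (ρT c) ε t) ∧
            PowerWithin (n d) (ρS c) ε (spaceCost α ω.pts) ∧
            (∀ x : Sph d, PowerWithin (n d) 1 ε (insertCost α ω.pts x)) ∧
            (∀ i : Fin (n d), PowerWithin (n d) (ρD c) ε (deleteCost α ω.pts i)) := by
  refine ⟨queryExponent, fun c => 1 + queryExponent c, queryExponent, queryExponent_atTop, ?_,
    queryExponent_atTop, queryExponent_nhdsGT, ?_, queryExponent_nhdsGT, fun c hc n hn => ?_⟩
  · refine queryExponent_atTop.congr_left fun c => ?_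
    ring
  · refine queryExponent_nhdsGT.congr_left fun c => ?_
    ring
  have hκ0 := kappaStar_pos hc
  have hγ0 := gammaStar_pos hc
  -- The shift by 2 keeps the value at k = 0 strictly between 0 and κ*.
  let κ : ℕ → ℝ := fun k => kappaStar c * (1 - 1 / ((k : ℝ) + 2))
  have hfrac : ∀ k : ℕ, 0 < 1 / ((k : ℝ) + 2) ∧ 1 / ((k : ℝ) + 2) < 1 := fun k =>
    ⟨by positivity, by rw [div_lt_one (by positivity)]; linarith [Nat.cast_nonneg (α := ℝ) k]⟩
  have hκpos : ∀ k, 0 < κ k := fun k => mul_pos hκ0 (by linarith [(hfrac k).2])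
  have hκlt : ∀ k, κ k < kappaStar c := fun k =>
    mul_lt_of_lt_one_right hκ0 (by linarith [(hfrac k).1])
  have hκlim : Tendsto κ atTop (𝓝 (kappaStar c)) := by
    have h1 : Tendsto (fun k : ℕ => 1 / ((k : ℝ) + 2)) atTop (𝓝 0) := by
      have := (tendsto_one_div_add_atTop_nhds_zero_nat (𝕜 := ℝ)).comp (tendsto_add_atTop_nat 1)
      refine this.congr fun k => ?_
      simp only [Function.comp_apply]
      push_cast
      ring
    have h2 := (h1.const_sub 1).const_mul (kappaStar c)
    rw [sub_zero, mul_one] at h2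
    exact h2
  have hgood : ∀ k, WithHighProbability n fun d ω =>
      GoodSample (κ k * muParam d (n d)) (gammaStar c) (1 - κ k ^ 2) (1 / ((k : ℝ) + 1)) ω := by
    intro k
    refine hn.withHighProbability_goodSample hγ0 (gammaStar_lt_one hc) (hκpos k) ?_ (by positivity)
    have h1 : κ k ^ 2 < kappaStar c ^ 2 := by
      have := hκpos k
      have := hκlt k
      gcongr
    rw [kappaStar_sq, lt_div_iff₀ (by positivity)] at h1
    exact h1
  -- Along the diagonal, κ tends to κ* and the tolerance 1/(k + 1) tends to 0, so a single choice of
  -- α serves every ε.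
  obtain ⟨k, hk, hkf⟩ := exists_tendsto_diagonal hgood
  refine ⟨fun d => κ (k d), fun d => ⟨hκpos _, hκlt _⟩, hκlim.comp hk, fun ε hε => ?_⟩
  have hlim : Tendsto (fun k : ℕ => |1 - κ k ^ 2 - queryExponent c| + 1 / ((k : ℝ) + 1)) atTop
      (𝓝 0) := by
    have h1 := (((hκlim.pow 2).const_sub 1).sub_const (queryExponent c)).abs
    rw [queryExponent_eq, sub_self, abs_zero] at h1
    have h2 := h1.add (tendsto_one_div_add_atTop_nhds_zero_nat (𝕜 := ℝ))
    rw [add_zero] at h2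
    rw [queryExponent_eq]
    exact h2
  refine tendsto_of_tendsto_of_tendsto_of_le_of_le' tendsto_const_nhds hkf
    (Eventually.of_forall fun _ => zero_le) ?_
  filter_upwards [(hlim.comp hk).eventually_lt_const hε, hn.eventually_pos] with d h1 h2
  refine measure_mono (Set.image_mono fun ω hω hg => hω ?_)
  exact GoodSample.mono h2 h1.le hg
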